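/- Let $(\Omega,\mathcal F)$ be a measurable space, let $\mathcal P$ be the set of probability measures $P$ on $(\Omega,\mathcal F)$ that are atomless, i.e. under which some random variable $U:\Omega\to\mathbb R$ is uniformly distributed on $[0,1]$, and let $\mathcal X$ be the vector space of bounded random variables $X:\Omega\to\mathbb R$. A (real-valued) core is a map $\Psi:\mathcal X\times\mathcal P\to\mathbb R$, $(X,P)\mapsto\Psi(X\mid P)$. Call $\Psi$ - strongly law-invariant if $\Psi(X\mid P)=\Psi(Y\mid Q)$ for all $X,Y\in\mathcal X$ and $P,Q\in\mathcal P$ such that the distribution of $X$ under $P$ equals that of $Y$ under $Q$; - loss law-invariant if $\Psi(X\mid P)=\Psi(Y\mid P)$ for all $X,Y\in\mathcal X$ and $P\in\mathcal P$ such that $X$ and $Y$ have the same distribution under $P$; - ambiguity sensitive if $\Psi(X\mid \lambda P+(1-\lambda)Q)\ge\lambda\Psi(X\mid P)+(1-\lambda)\Psi(X\mid Q)$ for all $X\in\mathcal X$, $P,Q\in\mathcal P$, $\lambda\in[0,1]$, and moreover $\Psi(\mathbf 1_A\mid \lambda P+(1-\lambda)Q)=\lambda\Psi(\mathbf 1_A\mid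 P)+(1-\lambda)\Psi(\mathbf 1_A\mid Q)$ for all $P,Q\in\mathcal P$, $\lambda\in[0,1]$ and all $A\in\mathcal F$ with $P(A)=Q(A)$; - monetary if for every $P\in\mathcal P$ it is monotone ($\Psi(X\mid P)\le\Psi(Y\mid P)$ for $X,Y\in\mathcal X$ with $X\le Y$ pointwise) and cash-additive ($\Psi(X+m\mid P)=\Psi(X\mid P)+m$ for $X\in\mathcal X$, $m\in\mathbb R$); - coherent if it is monetary and for every $P\in\mathcal P$ positively homogeneous ($\Psi(\lambda X\mid P)=\lambda\Psi(X\mid P)$ for $\lambda>0$, $X\in\mathcal X$) and subadditive ($\Psi(X+Y\mid P)\le\Psi(X\mid P)+\Psi(Y\mid P)$ for $X,Y\in\mathcal X$); - comonotonic additive if $\Psi(X+Y\mid P)=\Psi(X\mid P)+\Psi(Y\mid P)$ for every $P\in\mathcal P$ and all $X,Y\in\mathcal X$ with $(X(\omega)-X(\omega'))(Y(\omega)-Y(\omega'))\ge0$ for all $\omega,\omega'\in\Omega$. For every core $\Psi$ the following are equivalent. (i) $\Psi$ is loss law-invariant, ambiguity sensitive, monetary and comonotonic additive. (ii) $\Psi$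 is strongly law-invariant, coherent and comonotonic additive. (iii) There is a nondecreasing concave function $h:[0,1]\to[0,1]$ with $h(0)=0$ and $h(1)=1$, not depending on $P$, such that for all $X\in\mathcal X$ and $P\in\mathcal P$ $$\Psi(X\mid P)=\int X\,\mathrm d(h\circ P)=\int_{-\infty}^0\bigl(h(P(X\ge x))-1\bigr)\,\mathrm dx+\int_0^\infty h(P(X\ge x))\,\mathrm dx .$$ -/

import Mathlib

open MeasureTheory Set

noncomputable section

namespace RiskCore

/-- A measure on `Ω` is atomless if some random variable is uniformly distributed on `[0, 1]`
under it. -/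
def IsAtomless {Ω : Type*} [MeasurableSpace Ω] (P : Measure Ω) : Prop :=
  ∃ U : Ω → ℝ, Measurable U ∧ P.map U = volume.restrict (Icc (0 : ℝ) 1)

/-- The class of atomless probability measures on `(Ω, 𝓕)`. -/
structure Scenario (Ω : Type*) [MeasurableSpace Ω] where
  /-- the underlying measure -/
  measure : Measure Ω
  isProbabilityMeasure : IsProbabilityMeasure measure
  isAtomless : IsAtomless measure

/-- The probability of an event, as a real number. -/
def Scenario.prob {Ω : Type*} [MeasurableSpace Ω] (P : Scenario Ω) (A : Set Ω) : ℝ :=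
  P.measure.real A

/-- The vector space of bounded random variables on `(Ω, 𝓕)`. -/
def BoundedRV (Ω : Type*) [MeasurableSpace Ω] : Submodule ℝ (Ω → ℝ) where
  carrier := {X | Measurable X ∧ ∃ C : ℝ, ∀ ω, |X ω| ≤ C}
  zero_mem' := ⟨measurable_const, 0, fun ω => by simp⟩
  add_mem' := by
    rintro X Y ⟨hX, C, hC⟩ ⟨hY, D, hD⟩
    exact ⟨hX.add hY, C + D, fun ω => (abs_add_le _ _).trans (add_le_add (hC ω) (hD ω))⟩
  smul_mem' := by
    rintro c X ⟨hX, C, hC⟩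
    refine ⟨hX.const_smul c, |c| * C, fun ω => ?_⟩
    simp only [Pi.smul_apply, smul_eq_mul, abs_mul]
    exact mul_le_mul_of_nonneg_left (hC ω) (abs_nonneg c)

/-- The constant random variable `m`. -/
def constRV (Ω : Type*) [MeasurableSpace Ω] (m : ℝ) : BoundedRV Ω :=
  ⟨fun _ => m, measurable_const, |m|, fun _ => le_rfl⟩

/-- The indicator random variable of a measurable set `A`. -/
def indicatorRV {Ω : Type*} [MeasurableSpace Ω] (A : Set Ω) (hA : MeasurableSet A) :
    BoundedRV Ω :=
  ⟨A.indicator (fun _ => (1 : ℝ)), measurable_const.indicator hA, 1, fun ω => by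
    by_cases h : ω ∈ A <;> simp [h]⟩

/-- `X` under `P` and `Y` under `Q` have the same distribution. -/
def SameLaw {Ω : Type*} [MeasurableSpace Ω] (X : BoundedRV Ω) (P : Scenario Ω)
    (Y : BoundedRV Ω) (Q : Scenario Ω) : Prop :=
  P.measure.map (X : Ω → ℝ) = Q.measure.map (Y : Ω → ℝ)

/-- The distribution function of a probability measure on `ℝ` without point masses is uniformly
distributed under that measure. -/
theorem map_cdf_eq_uniform (ρ : Measure ℝ) [IsProbabilityMeasure ρ] [NullSingletonClass ρ] :
    ρ.map (ProbabilityTheory.cdf ρ) = volume.restrict (Icc (0 : ℝ) 1) := by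
  set F := ProbabilityTheory.cdf ρ with hF
  have hmono : Monotone F := F.mono
  have hcont : Continuous F := by
    rw [continuous_iff_continuousAt]
    intro a
    rw [hmono.continuousAt_iff_leftLim_eq_rightLim, F.rightLim_eq]
    have h := F.measure_singleton a
    rw [hF, ProbabilityTheory.measure_cdf, measure_singleton, ← hF] at h
    have h2 := ENNReal.ofReal_eq_zero.1 h.symm
    exact le_antisymm (hmono.leftLim_le le_rfl) (by linarith)
  have hmeas : Measurable F := hmono.measurable
  have : IsProbabilityMeasure (ρ.map F) :=
    Measure.isProbabilityMeasure_map hmeas.aemeasurable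
  refine Measure.ext_of_Iic _ _ fun t => ?_
  rw [Measure.map_apply hmeas measurableSet_Iic, Measure.restrict_apply measurableSet_Iic]
  rcases lt_or_ge t 0 with ht0 | ht0
  · have h1 : F ⁻¹' Iic t = ∅ := by
      ext x
      have := ProbabilityTheory.cdf_nonneg ρ x
      simp only [mem_preimage, mem_Iic, mem_empty_iff_false, iff_false, not_le]
      linarith
    have h2 : Iic t ∩ Icc (0 : ℝ) 1 = ∅ := by
      ext x
      simp only [mem_inter_iff, mem_Iic, mem_Icc, mem_empty_iff_false, iff_false]
      rintro ⟨h, h', -⟩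
      linarith
    rw [h1, h2]
    simp
  rcases le_or_gt 1 t with ht1 | ht1
  · have h1 : F ⁻¹' Iic t = univ := by
      ext x
      have := ProbabilityTheory.cdf_le_one ρ x
      simp only [mem_preimage, mem_Iic, mem_univ, iff_true]
      linarith
    have h2 : Iic t ∩ Icc (0 : ℝ) 1 = Icc 0 1 := by
      ext x
      simp only [mem_inter_iff, mem_Iic, mem_Icc, and_iff_right_iff_imp]
      rintro ⟨-, h⟩
      linarith
    rw [h1, h2]
    simp
  have h2 : Iic t ∩ Icc (0 : ℝ) 1 = Icc 0 t := by
    ext x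
    simp only [mem_inter_iff, mem_Iic, mem_Icc]
    constructor
    · rintro ⟨h, h', -⟩
      exact ⟨h', h⟩
    · rintro ⟨h, h'⟩
      exact ⟨h', h, by linarith⟩
  rw [h2, Real.volume_Icc, sub_zero]
  have ivt : ∀ s : ℝ, 0 < s → s < 1 → ∃ x, F x = s := fun s hs0 hs1 =>
    mem_range_of_exists_le_of_exists_ge hcont
      (((ProbabilityTheory.tendsto_cdf_atBot ρ).eventually (ge_mem_nhds hs0)).exists)
      (((ProbabilityTheory.tendsto_cdf_atTop ρ).eventually (le_mem_nhds hs1)).exists)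
  apply le_antisymm
  · refine le_of_forall_gt_imp_ge_of_dense fun c hc => ?_
    rcases le_or_gt 1 c with h | h
    · exact prob_le_one.trans h
    have hcfin : c ≠ ⊤ := (h.trans ENNReal.one_lt_top).ne
    have hct : t < c.toReal := (ENNReal.ofReal_lt_iff_lt_toReal ht0 hcfin).1 hc
    have hc1 : c.toReal < 1 := by
      have := (ENNReal.toReal_lt_toReal hcfin ENNReal.one_ne_top).2 h
      simpa using this
    obtain ⟨x, hx⟩ := ivt c.toReal (by linarith) hc1
    calc ρ (F ⁻¹' Iic t) ≤ ρ (Iic x) := by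
          refine measure_mono fun y hy => ?_
          simp only [mem_preimage, mem_Iic] at hy ⊢
          by_contra hxy
          have := hmono (not_le.1 hxy).le
          linarith
      _ = ENNReal.ofReal (F x) := (ProbabilityTheory.ofReal_cdf ρ x).symm
      _ = c := by rw [hx, ENNReal.ofReal_toReal hcfin]
  · rcases ht0.eq_or_lt with h | h
    · simp [← h]
    obtain ⟨x, hx⟩ := ivt t h ht1
    calc ENNReal.ofReal t = ρ (Iic x) := by rw [← hx, ProbabilityTheory.ofReal_cdf]
      _ ≤ ρ (F ⁻¹' Iic t) := by
          refine measure_mono fun y hy => ?_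
          simp only [mem_preimage, mem_Iic] at hy ⊢
          exact (hmono hy).trans hx.le

/-- A uniform random variable takes each value with probability zero. -/
theorem measure_preimage_singleton_of_uniform {Ω : Type*} [MeasurableSpace Ω] {P : Measure Ω}
    {U : Ω → ℝ} (hU : Measurable U) (h : P.map U = volume.restrict (Icc (0 : ℝ) 1)) (x : ℝ) :
    P (U ⁻¹' {x}) = 0 := by
  rw [← Measure.map_apply hU (measurableSet_singleton x), h]
  exact measure_singleton x

/-- A mixture of atomless probability measures is an atomless probability measure. -/
theorem isAtomless_mix {Ω : Type*} [MeasurableSpace Ω] {P Q : Measure Ω} (hP : IsAtomless P)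
    (hQ : IsAtomless Q) (a b : ENNReal) (hR : IsProbabilityMeasure (a • P + b • Q)) :
    IsAtomless (a • P + b • Q) := by
  obtain ⟨U, hU, hUP⟩ := hP
  obtain ⟨V, hV, hVQ⟩ := hQ
  let e : ℝ × ℝ ≃ᵐ ℝ := PolishSpace.measurableEquivOfNotCountable
    (not_countable_iff.2 inferInstance) (not_countable_iff.2 inferInstance)
  have hW : Measurable fun ω => e (U ω, V ω) := e.measurable.comp (hU.prodMk hV)
  set ρ := (a • P + b • Q).map fun ω => e (U ω, V ω) with hρ
  have : IsProbabilityMeasure ρ := Measure.isProbabilityMeasure_map hW.aemeasurable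
  have : NullSingletonClass ρ := ⟨fun x => by
    rw [hρ, Measure.map_apply hW (measurableSet_singleton x)]
    have h1 : P ((fun ω => e (U ω, V ω)) ⁻¹' {x}) = 0 := by
      refine measure_mono_null ?_
        (measure_preimage_singleton_of_uniform hU hUP (e.symm x).1)
      rintro ω rfl
      simp
    have h2 : Q ((fun ω => e (U ω, V ω)) ⁻¹' {x}) = 0 := by
      refine measure_mono_null ?_
        (measure_preimage_singleton_of_uniform hV hVQ (e.symm x).2)
      rintro ω rfl
      simp
    simp [h1, h2]⟩
  have hF : Measurable (ProbabilityTheory.cdf ρ) :=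
    (ProbabilityTheory.monotone_cdf ρ).measurable
  refine ⟨fun ω => ProbabilityTheory.cdf ρ (e (U ω, V ω)), hF.comp hW, ?_⟩
  rw [← map_cdf_eq_uniform ρ]
  exact (Measure.map_map hF hW).symm

/-- The mixture `t P + (1 - t) Q`, for `t ∈ [0, 1]`. -/
def Scenario.mix {Ω : Type*} [MeasurableSpace Ω] (t : ℝ) (ht : t ∈ Icc (0 : ℝ) 1)
    (P Q : Scenario Ω) : Scenario Ω :=
  have hR : IsProbabilityMeasure
      (ENNReal.ofReal t • P.measure + ENNReal.ofReal (1 - t) • Q.measure) := by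
    have := P.isProbabilityMeasure
    have := Q.isProbabilityMeasure
    constructor
    simp only [Measure.coe_add, Measure.coe_smul, Pi.add_apply, Pi.smul_apply, measure_univ,
      smul_eq_mul, mul_one]
    rw [← ENNReal.ofReal_add ht.1 (sub_nonneg.2 ht.2)]
    simp
  { measure := ENNReal.ofReal t • P.measure + ENNReal.ofReal (1 - t) • Q.measure
    isProbabilityMeasure := hR
    isAtomless := isAtomless_mix P.isAtomless Q.isAtomless _ _ hR }

/-- A core: a real risk value `Ψ(X | P)` for each bounded random variable `X` and each atomless
probability measure `P`. For each fixed `P`, the map `X ↦ Ψ(X | P)` is a (real-valued) risk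
measure in the traditional sense. -/
abbrev Core (Ω : Type*) [MeasurableSpace Ω] : Type _ := BoundedRV Ω → Scenario Ω → ℝ

/-- `X` and `Y` are comonotonic. -/
def Comonotonic {Ω : Type*} [MeasurableSpace Ω] (X Y : BoundedRV Ω) : Prop :=
  ∀ ω ω' : Ω, 0 ≤ (X.1 ω - X.1 ω') * (Y.1 ω - Y.1 ω')

namespace Core

/-- Strong law invariance. -/
def StronglyLawInvariant {Ω : Type*} [MeasurableSpace Ω] (Ψ : Core Ω) : Prop :=
  ∀ (X Y : BoundedRV Ω) (P Q : Scenario Ω), SameLaw X P Y Q → Ψ X P = Ψ Y Q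

/-- Loss law invariance. -/
def LossLawInvariant {Ω : Type*} [MeasurableSpace Ω] (Ψ : Core Ω) : Prop :=
  ∀ (X Y : BoundedRV Ω) (P : Scenario Ω), SameLaw X P Y P → Ψ X P = Ψ Y P

/-- Ambiguity sensitivity. -/
def AmbiguitySensitive {Ω : Type*} [MeasurableSpace Ω] (Ψ : Core Ω) : Prop :=
  (∀ (X : BoundedRV Ω) (P Q : Scenario Ω) (t : ℝ) (ht : t ∈ Icc (0 : ℝ) 1),
    t * Ψ X P + (1 - t) * Ψ X Q ≤ Ψ X (Scenario.mix t ht P Q)) ∧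
  (∀ (A : Set Ω) (hA : MeasurableSet A) (P Q : Scenario Ω) (t : ℝ) (ht : t ∈ Icc (0 : ℝ) 1),
    P.prob A = Q.prob A →
      Ψ (indicatorRV A hA) (Scenario.mix t ht P Q) =
        t * Ψ (indicatorRV A hA) P + (1 - t) * Ψ (indicatorRV A hA) Q)

/-- Monotonicity. -/
def IsMonotone {Ω : Type*} [MeasurableSpace Ω] (Ψ : Core Ω) : Prop :=
  ∀ (P : Scenario Ω) (X Y : BoundedRV Ω), (∀ ω, X.1 ω ≤ Y.1 ω) → Ψ X P ≤ Ψ Y P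

/-- Cash-additivity. -/
def CashAdditive {Ω : Type*} [MeasurableSpace Ω] (Ψ : Core Ω) : Prop :=
  ∀ (P : Scenario Ω) (X : BoundedRV Ω) (m : ℝ), Ψ (X + constRV Ω m) P = Ψ X P + m

/-- Positive homogeneity. -/
def PositivelyHomogeneous {Ω : Type*} [MeasurableSpace Ω] (Ψ : Core Ω) : Prop :=
  ∀ (P : Scenario Ω) (X : BoundedRV Ω) (c : ℝ), 0 < c → Ψ (c • X) P = c * Ψ X P

/-- Subadditivity. -/
def Subadditive {Ω : Type*} [MeasurableSpace Ω] (Ψ : Core Ω) : Prop :=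
  ∀ (P : Scenario Ω) (X Y : BoundedRV Ω), Ψ (X + Y) P ≤ Ψ X P + Ψ Y P

/-- Comonotonic additivity. -/
def ComonotonicAdditive {Ω : Type*} [MeasurableSpace Ω] (Ψ : Core Ω) : Prop :=
  ∀ (P : Scenario Ω) (X Y : BoundedRV Ω), Comonotonic X Y → Ψ (X + Y) P = Ψ X P + Ψ Y P

/-- A core is monetary if it is monotone and cash-additive. -/
def Monetary {Ω : Type*} [MeasurableSpace Ω] (Ψ : Core Ω) : Prop :=
  Ψ.IsMonotone ∧ Ψ.CashAdditive

/-- A core is coherent if it is monetary, positively homogeneous and subadditive. -/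
def Coherent {Ω : Type*} [MeasurableSpace Ω] (Ψ : Core Ω) : Prop :=
  Ψ.IsMonotone ∧ Ψ.CashAdditive ∧ Ψ.PositivelyHomogeneous ∧ Ψ.Subadditive

end Core

/-- The Choquet integral of `X` with respect to a set function `ν`. For increasing `ν` and bounded
`X` both integrands are monotone and vanish outside a bounded interval, so both integrals exist. -/
def choquet {Ω : Type*} (X : Ω → ℝ) (ν : Set Ω → ℝ) : ℝ :=
  (∫ x in Iio (0 : ℝ), (ν {ω | x ≤ X ω} - ν univ)) + ∫ x in Ioi (0 : ℝ), ν {ω | x ≤ X ω}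

/-- `h` restricts to a nondecreasing concave function `[0, 1] → [0, 1]` with `h 0 = 0`, `h 1 = 1`;
its values outside `[0, 1]` are irrelevant. -/
structure IsConcaveDistortion (h : ℝ → ℝ) : Prop where
  mapsTo : MapsTo h (Icc 0 1) (Icc 0 1)
  monotone : MonotoneOn h (Icc 0 1)
  concave : ConcaveOn ℝ (Icc 0 1) h
  zero : h 0 = 0
  one : h 1 = 1

end RiskCore

end

noncomputable section

namespace RiskCore

/-! Loss law invariance makes the risk of an indicator `1_A` under `P` a function `u_P(P(A))`. A
monotone, cash-additive, comonotonic additive functional is determined by its values on indicators: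
an integer-valued variable is the sum of the indicators of its upper level sets, each comonotonic
with the sum of the earlier ones, and `n X` differs from its integer part by at most `1`. Hence `Ψ(·
| P)` is the Choquet integral with respect to `u_P ∘ P` (`Core.eq_choquet_distortion`). For (iii) it
remains to show that `u_P` is concave and does not depend on `P`.

Under (ii), independence of `P` is strong law invariance. Subadditivity makes `u_P ∘ P` submodular,
so the increments of `u_P` over intervals of equal length decrease; with monotonicity this gives
concavity.

Under (i), take mutually singular `P` and `Q`. An event can be given any probabilities `a` and `b`
under them, so the two halves of ambiguity sensitivity combine into the inequality
`MixtureDominated`. It bounds each increment of `u_P` by the preceding increment of `u_Q`, and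
conversely, which forces `u_P = u_Q`; the inequality then is concavity. An arbitrary `P` is the
mixture of its conditionals on `B` and `Bᶜ`, which are singular and so share their distortion, and
`P` inherits it. Two arbitrary scenarios are linked through singular conditionals.

Conversely, concavity of `h` makes `h ∘ P` submodular, whence subadditivity of the Choquet integral,
and concavity of `h` integrated over the levels of `X` gives ambiguity sensitivity. Additivity
properties of the Choquet integral are proved for integer-valued functions and transferred by
scaling: the error for `n X` is bounded independently of `n`, hence vanishes after division by `n`.
-/

theorem nonpos_of_forall_nat_mul_le {a c : ℝ} (h : ∀ n : ℕ, 0 < n → n * a ≤ c) : a ≤ 0 := by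
  by_contra! ha
  obtain ⟨n, hn⟩ := exists_nat_gt (c / a)
  have h1 := h (n + 1) n.succ_pos
  rw [div_lt_iff₀ ha] at hn
  push_cast at h1
  nlinarith

/-- A normalized monotone set function. -/
structure IsCapacity {Ω : Type*} (ν : Set Ω → ℝ) : Prop where
  mono : Monotone ν
  empty : ν ∅ = 0
  univ : ν univ = 1

/-! ### Choquet integrals with respect to a capacity -/

section Choquet

variable {Ω : Type*} {ν : Set Ω → ℝ} {X Y : Ω → ℝ}

theorem IsCapacity.antitone_superlevel (hν : IsCapacity ν) (X : Ω → ℝ) :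
    Antitone fun x : ℝ => ν {ω | x ≤ X ω} :=
  fun _ _ hxy => hν.mono fun _ hω => hxy.trans hω

theorem IsCapacity.nonneg (hν : IsCapacity ν) (A : Set Ω) : 0 ≤ ν A :=
  hν.empty ▸ hν.mono (empty_subset A)

theorem IsCapacity.le_one (hν : IsCapacity ν) (A : Set Ω) : ν A ≤ 1 :=
  hν.univ ▸ hν.mono (subset_univ A)

/-- The Choquet integral of a bounded function as one integral over a bounded interval. -/
theorem choquet_eq_integral (hν : IsCapacity ν) {a b : ℝ} (ha : a ≤ 0) (hb : 0 ≤ b)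
    (haX : ∀ ω, a ≤ X ω) (hXb : ∀ ω, X ω ≤ b) :
    choquet X ν = (∫ x in a..b, ν {ω | x ≤ X ω}) + a := by
  have hanti := hν.antitone_superlevel X
  have h1 : (∫ x in Iio (0 : ℝ), (ν {ω | x ≤ X ω} - ν univ))
      = (∫ x in a..0, ν {ω | x ≤ X ω}) + a := by
    rw [← integral_Iic_eq_integral_Iio,
      setIntegral_eq_of_subset_of_forall_sdiff_eq_zero measurableSet_Iic
        (Ioc_subset_Iic_self : Ioc a 0 ⊆ Iic 0), ← intervalIntegral.integral_of_le ha,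
      intervalIntegral.integral_sub hanti.intervalIntegrable intervalIntegrable_const,
      intervalIntegral.integral_const, hν.univ]
    · simp
    · rintro x ⟨hx0, hx⟩
      have hxa : x ≤ a := by
        by_contra! h
        exact hx ⟨h, hx0⟩
      have : {ω | x ≤ X ω} = univ := eq_univ_of_forall fun ω => hxa.trans (haX ω)
      rw [this, sub_self]
  have h2 : (∫ x in Ioi (0 : ℝ), ν {ω | x ≤ X ω}) = ∫ x in (0 : ℝ)..b, ν {ω | x ≤ X ω} := by
    rw [intervalIntegral.integral_of_le hb]
    refine setIntegral_eq_of_subset_of_forall_sdiff_eq_zero measurableSet_Ioi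
      Ioc_subset_Ioi_self ?_
    rintro x ⟨hx0, hx⟩
    have hxb : b < x := by
      by_contra! h
      exact hx ⟨hx0, h⟩
    have : {ω | x ≤ X ω} = ∅ :=
      eq_empty_of_forall_notMem fun ω hω => absurd (hXb ω) (not_le.2 (hxb.trans_le hω))
    rw [this, hν.empty]
  rw [choquet, h1, h2, ← intervalIntegral.integral_add_adjacent_intervals
    (hanti.intervalIntegrable (a := a) (b := 0)) (hanti.intervalIntegrable (a := 0) (b := b))]
  ring

theorem choquet_mono (hν : IsCapacity ν) {C : ℝ} (hX : ∀ ω, |X ω| ≤ C) (hY : ∀ ω, |Y ω| ≤ C)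
    (hXY : ∀ ω, X ω ≤ Y ω) : choquet X ν ≤ choquet Y ν := by
  have hC : ∀ {Z : Ω → ℝ}, (∀ ω, |Z ω| ≤ C) → ∀ ω, |Z ω| ≤ |C| :=
    fun h ω => (h ω).trans (le_abs_self C)
  have h0 := abs_nonneg C
  rw [choquet_eq_integral hν (neg_nonpos.2 h0) h0 (fun ω => (abs_le.1 (hC hX ω)).1)
      fun ω => (abs_le.1 (hC hX ω)).2,
    choquet_eq_integral hν (neg_nonpos.2 h0) h0 (fun ω => (abs_le.1 (hC hY ω)).1)
      fun ω => (abs_le.1 (hC hY ω)).2]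
  gcongr
  exact intervalIntegral.integral_mono_on (by linarith)
    (hν.antitone_superlevel X).intervalIntegrable (hν.antitone_superlevel Y).intervalIntegrable
    fun x _ => hν.mono fun ω hω => le_trans hω (hXY ω)

theorem choquet_add_const (hν : IsCapacity ν) {C : ℝ} (hX : ∀ ω, |X ω| ≤ C) (m : ℝ) :
    choquet (fun ω => X ω + m) ν = choquet X ν + m := by
  have hC : ∀ ω, |X ω| ≤ |C| := fun ω => (hX ω).trans (le_abs_self C)
  have h0 := abs_nonneg C
  have hm := abs_nonneg m
  have hm1 := le_abs_self m
  have hm2 := neg_abs_le m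
  rw [choquet_eq_integral hν (a := -(|C| + |m|)) (b := |C| + |m|) (by linarith) (by linarith)
      (fun ω => by have := (abs_le.1 (hC ω)).1; linarith)
      fun ω => by have := (abs_le.1 (hC ω)).2; linarith,
    choquet_eq_integral (X := X) hν (a := -(|C| + |m|) - m) (b := |C| + |m| - m)
      (by linarith) (by linarith)
      (fun ω => by have := (abs_le.1 (hC ω)).1; linarith)
      fun ω => by have := (abs_le.1 (hC ω)).2; linarith]
  have := intervalIntegral.integral_comp_sub_right (a := -(|C| + |m|)) (b := |C| + |m|)
    (fun x => ν {ω | x ≤ X ω}) m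
  simp only [sub_le_iff_le_add] at this
  rw [this]
  ring

theorem choquet_const_mul (hν : IsCapacity ν) {C : ℝ} (hX : ∀ ω, |X ω| ≤ C) {c : ℝ}
    (hc : 0 < c) : choquet (fun ω => c * X ω) ν = c * choquet X ν := by
  have hC : ∀ ω, |X ω| ≤ |C| := fun ω => (hX ω).trans (le_abs_self C)
  have h0 := abs_nonneg C
  rw [choquet_eq_integral hν (a := c * -|C|) (b := c * |C|)
      (by nlinarith) (by positivity)
      (fun ω => mul_le_mul_of_nonneg_left (abs_le.1 (hC ω)).1 hc.le)
      fun ω => mul_le_mul_of_nonneg_left (abs_le.1 (hC ω)).2 hc.le,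
    choquet_eq_integral (X := X) hν (neg_nonpos.2 h0) h0 (fun ω => (abs_le.1 (hC ω)).1)
      fun ω => (abs_le.1 (hC ω)).2]
  have := intervalIntegral.integral_comp_div (a := c * -|C|) (b := c * |C|)
    (fun x => ν {ω | x ≤ X ω}) hc.ne'
  rw [mul_div_cancel_left₀ _ hc.ne', mul_div_cancel_left₀ _ hc.ne', smul_eq_mul] at this
  simp only [div_le_iff₀' hc] at this
  rw [this]
  ring

/-- The sum of the values of `ν` on the first `M` layers of `f`: the Choquet integral of a
function with values in `{0, …, M}`. -/
def layerSum (ν : Set Ω → ℝ) (M : ℕ) (f : Ω → ℕ) : ℝ :=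
  ∑ k ∈ Finset.range M, ν {ω | k + 1 ≤ f ω}

theorem layerSum_neg (ν : Set Ω → ℝ) (M : ℕ) (f : Ω → ℕ) :
    layerSum (fun A => -ν A) M f = -layerSum ν M f := by
  simp [layerSum]

/-- Submodularity of `ν` between consecutive layers of `f`, cut by `C`. -/
def LayerSubmodular (ν : Set Ω → ℝ) (f : Ω → ℕ) (C : Set Ω) : Prop :=
  ∀ k : ℕ, ν ({ω | k + 1 ≤ f ω} ∪ ({ω | k ≤ f ω} ∩ C)) + ν ({ω | k + 1 ≤ f ω} ∩ C) ≤
    ν {ω | k + 1 ≤ f ω} + ν ({ω | k ≤ f ω} ∩ C)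

/-- Layer `k + 1` of `f + 1_C` is the union appearing in `LayerSubmodular`. Summing that inequality
over `k`, the terms cut by `C` telescope from `ν C` down to `ν ∅`; strictness of `f < M` makes the
last one empty. -/
theorem layerSum_add_indicator_le (h0 : ν ∅ = 0) {M : ℕ} {f : Ω → ℕ} (hf : ∀ ω, f ω < M)
    {C : Set Ω} (H : LayerSubmodular ν f C) :
    layerSum ν M (fun ω => f ω + C.indicator 1 ω) ≤ layerSum ν M f + ν C := by
  have hset : ∀ k : ℕ, {ω | k + 1 ≤ f ω + C.indicator 1 ω}
      = {ω | k + 1 ≤ f ω} ∪ ({ω | k ≤ f ω} ∩ C) := by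
    intro k
    ext ω
    by_cases h : ω ∈ C <;> simp [h]
    omega
  have htel := Finset.sum_range_sub' (fun k => ν ({ω | k ≤ f ω} ∩ C)) M
  have hM : {ω | M ≤ f ω} ∩ C = ∅ :=
    eq_empty_of_forall_notMem fun ω hω => absurd (hf ω) (not_lt.2 hω.1)
  simp only [hM, h0, Nat.zero_le, ofPred_true, univ_inter, sub_zero] at htel
  rw [← htel, layerSum, layerSum, ← Finset.sum_add_distrib]
  refine Finset.sum_le_sum fun k _ => ?_
  rw [hset]
  linarith [H k]

/-- The function `g` is added to `f` one layer at a time, through the partial sums `f + min g i`. -/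
theorem layerSum_add_le (h0 : ν ∅ = 0) {M : ℕ} {f g : Ω → ℕ} (hfg : ∀ ω, f ω + g ω < M)
    (H : ∀ i : ℕ, LayerSubmodular ν (fun ω => f ω + min (g ω) i) {ω | i + 1 ≤ g ω}) :
    layerSum ν M (fun ω => f ω + g ω) ≤ layerSum ν M f + layerSum ν M g := by
  have key : ∀ i : ℕ, layerSum ν M (fun ω => f ω + min (g ω) i) ≤
      layerSum ν M f + ∑ k ∈ Finset.range i, ν {ω | k + 1 ≤ g ω} := by
    intro i
    induction i with
    | zero => simp
    | succ i ih =>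
      have h1 := layerSum_add_indicator_le h0 (M := M)
        (fun ω => by have := hfg ω; have := min_le_left (g ω) i; omega) (H i)
      have h2 : (fun ω => f ω + min (g ω) i + {ω | i + 1 ≤ g ω}.indicator 1 ω)
          = fun ω => f ω + min (g ω) (i + 1) := by
        funext ω
        by_cases h : i + 1 ≤ g ω
        · rw [indicator_of_mem (show ω ∈ {ω | i + 1 ≤ g ω} from h), Pi.one_apply]
          omega
        · rw [indicator_of_notMem (show ω ∉ {ω | i + 1 ≤ g ω} from h)]
          omega
      rw [h2] at h1
      rw [Finset.sum_range_succ]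
      linarith
  have h3 : (fun ω => f ω + min (g ω) M) = fun ω => f ω + g ω := by
    funext ω
    have := hfg ω
    omega
  have := key M
  rwa [h3] at this

/-- Comparing an antitone integrand with its sums at integers loses at most `1`, which is harmless
since the bound is only used after division by a large `n`. -/
theorem choquet_natCast_bounds (hν : IsCapacity ν) {M : ℕ} {f : Ω → ℕ} (hf : ∀ ω, f ω ≤ M) :
    layerSum ν M f ≤ choquet (fun ω => (f ω : ℝ)) ν ∧
      choquet (fun ω => (f ω : ℝ)) ν ≤ layerSum ν M f + 1 := by
  have hanti := hν.antitone_superlevel fun ω => (f ω : ℝ)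
  have hS : layerSum ν M f
      = ∑ i ∈ Finset.range M, ν {ω | (0 : ℝ) + (i + 1 : ℕ) ≤ f ω} := by
    simp only [zero_add, Nat.cast_le, layerSum]
  rw [choquet_eq_integral hν le_rfl (Nat.cast_nonneg M) (fun _ => Nat.cast_nonneg _)
    fun ω => Nat.cast_le.2 (hf ω), add_zero, hS]
  have h1 := AntitoneOn.sum_le_integral (x₀ := 0) (a := M) (hanti.antitoneOn _)
  have h2 := AntitoneOn.integral_le_sum (x₀ := 0) (a := M) (hanti.antitoneOn _)
  have h3 := Finset.sum_range_sub' (fun i : ℕ => ν {ω | (0 : ℝ) + (i : ℕ) ≤ f ω}) M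
  rw [Finset.sum_sub_distrib] at h3
  have h4 := hν.le_one {ω | (0 : ℝ) + (0 : ℕ) ≤ f ω}
  have h5 := hν.nonneg {ω | (0 : ℝ) + (M : ℕ) ≤ f ω}
  rw [zero_add (M : ℝ)] at h1 h2
  exact ⟨h1, by linarith⟩

/-- Here `c` is the rounding error of the integer approximation (`1` for one floor, `2` for two);
the extra `1` comes from comparing sum and integral. -/
theorem nat_mul_choquet_bounds (hν : IsCapacity ν) {M n : ℕ} (hn : 0 < n) {f : Ω → ℕ}
    (hf : ∀ ω, f ω ≤ M) {c : ℝ} (h1 : ∀ ω, (f ω : ℝ) ≤ n * X ω)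
    (h2 : ∀ ω, n * X ω ≤ f ω + c) :
    layerSum ν M f ≤ n * choquet X ν ∧ n * choquet X ν ≤ layerSum ν M f + (c + 1) := by
  have hn' : (0 : ℝ) < n := Nat.cast_pos.2 hn
  have hfM : ∀ ω, |(f ω : ℝ)| ≤ M + |c| := fun ω => by
    rw [abs_of_nonneg (Nat.cast_nonneg _)]
    have : (f ω : ℝ) ≤ M := Nat.cast_le.2 (hf ω)
    linarith [abs_nonneg c]
  have hX : ∀ ω, |n * X ω| ≤ M + |c| := fun ω => by
    have : (f ω : ℝ) ≤ M := Nat.cast_le.2 (hf ω)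
    rw [abs_of_nonneg ((Nat.cast_nonneg _).trans (h1 ω))]
    linarith [h2 ω, le_abs_self c]
  have hX' : ∀ ω, |X ω| ≤ (M + |c|) / n := fun ω => by
    rw [le_div_iff₀ hn', mul_comm]
    simpa [abs_mul] using hX ω
  have hfc : ∀ ω, |(f ω : ℝ) + c| ≤ M + |c| := fun ω => by
    refine (abs_add_le _ _).trans ?_
    rw [abs_of_nonneg (Nat.cast_nonneg _)]
    have : (f ω : ℝ) ≤ M := Nat.cast_le.2 (hf ω)
    linarith
  obtain ⟨b1, b2⟩ := choquet_natCast_bounds hν hf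
  have m1 := choquet_mono hν hfM hX h1
  have m2 := choquet_mono hν hX hfc h2
  rw [choquet_add_const hν hfM] at m2
  rw [← choquet_const_mul hν hX' hn']
  constructor <;> linarith

theorem nat_mul_choquet_floor_bounds (hν : IsCapacity ν) {M n : ℕ} (hn : 0 < n)
    (hX0 : ∀ ω, 0 ≤ X ω) (hM : ∀ ω, ⌊n * X ω⌋₊ ≤ M) :
    layerSum ν M (fun ω => ⌊n * X ω⌋₊) ≤ n * choquet X ν ∧
      n * choquet X ν ≤ layerSum ν M (fun ω => ⌊n * X ω⌋₊) + (1 + 1) :=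
  nat_mul_choquet_bounds hν hn hM
    (fun ω => Nat.floor_le (mul_nonneg (Nat.cast_nonneg _) (hX0 ω)))
    fun _ => (Nat.lt_floor_add_one _).le

theorem nat_mul_choquet_add_floor_bounds (hν : IsCapacity ν) {M n : ℕ} (hn : 0 < n)
    (hX0 : ∀ ω, 0 ≤ X ω) (hY0 : ∀ ω, 0 ≤ Y ω) (hM : ∀ ω, ⌊n * X ω⌋₊ + ⌊n * Y ω⌋₊ ≤ M) :
    layerSum ν M (fun ω => ⌊n * X ω⌋₊ + ⌊n * Y ω⌋₊) ≤ n * choquet (fun ω => X ω + Y ω) ν ∧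
      n * choquet (fun ω => X ω + Y ω) ν ≤
        layerSum ν M (fun ω => ⌊n * X ω⌋₊ + ⌊n * Y ω⌋₊) + (2 + 1) := by
  refine nat_mul_choquet_bounds hν hn hM (fun ω => ?_) fun ω => ?_
  · push_cast
    have := Nat.floor_le (mul_nonneg (Nat.cast_nonneg n) (hX0 ω))
    have := Nat.floor_le (mul_nonneg (Nat.cast_nonneg n) (hY0 ω))
    linarith
  · push_cast
    have := Nat.lt_floor_add_one (n * X ω)
    have := Nat.lt_floor_add_one (n * Y ω)
    linarith

theorem exists_nat_floor_add_lt {C : ℝ} (hX : ∀ ω, |X ω| ≤ C) (hY : ∀ ω, |Y ω| ≤ C) (n : ℕ) :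
    ∃ M : ℕ, ∀ ω, ⌊n * X ω⌋₊ + ⌊n * Y ω⌋₊ < M := by
  refine ⟨⌊n * C⌋₊ + ⌊n * C⌋₊ + 1, fun ω => ?_⟩
  have h1 : ⌊n * X ω⌋₊ ≤ ⌊n * C⌋₊ :=
    Nat.floor_le_floor (by gcongr; exact (le_abs_self _).trans (hX ω))
  have h2 : ⌊n * Y ω⌋₊ ≤ ⌊n * C⌋₊ :=
    Nat.floor_le_floor (by gcongr; exact (le_abs_self _).trans (hY ω))
  omega

/-- Shifting reduces an additivity property of the Choquet integral to nonnegative functions. -/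
theorem choquet_add_sub_shift (hν : IsCapacity ν) {C : ℝ} (hX : ∀ ω, |X ω| ≤ C)
    (hY : ∀ ω, |Y ω| ≤ C) (m : ℝ) :
    choquet (fun ω => (X ω + m) + (Y ω + m)) ν - choquet (fun ω => X ω + m) ν
        - choquet (fun ω => Y ω + m) ν
      = choquet (fun ω => X ω + Y ω) ν - choquet X ν - choquet Y ν := by
  have h : (fun ω => (X ω + m) + (Y ω + m)) = fun ω => X ω + Y ω + 2 * m := by
    funext ω
    ring
  rw [h, choquet_add_const hν hX, choquet_add_const hν hY,
    choquet_add_const hν (C := C + C)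
      (fun ω => (abs_add_le _ _).trans (add_le_add (hX ω) (hY ω)))]
  ring

/-- When the sets form a chain, submodularity is an equality, so this holds for every set function,
in particular for `ν` and `-ν`. -/
theorem layerSubmodular_of_nested (ν : Set Ω → ℝ) {f : Ω → ℕ} {C : Set Ω}
    (h : ∀ k : ℕ, {ω | k ≤ f ω} ⊆ C ∨ C ⊆ {ω | k ≤ f ω}) : LayerSubmodular ν f C := by
  intro k
  have hk : {ω | k + 1 ≤ f ω} ⊆ {ω | k ≤ f ω} := fun ω hω => Nat.le_of_succ_le hω
  rcases h (k + 1) with h | h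
  · rw [union_eq_self_of_subset_left (subset_inter hk h), inter_eq_self_of_subset_left h, add_comm]
  · rw [union_eq_self_of_subset_right (inter_subset_right.trans h),
      inter_eq_self_of_subset_right h, inter_eq_self_of_subset_right (h.trans hk)]

theorem choquet_add_of_comonotonic (hν : IsCapacity ν) {C : ℝ} (hX : ∀ ω, |X ω| ≤ C)
    (hY : ∀ ω, |Y ω| ≤ C) (hXY : ∀ ω ω', 0 ≤ (X ω - X ω') * (Y ω - Y ω')) :
    choquet (fun ω => X ω + Y ω) ν = choquet X ν + choquet Y ν := by
  suffices h : ∀ X Y : Ω → ℝ, (∀ ω, 0 ≤ X ω) → (∀ ω, 0 ≤ Y ω) → (∀ ω, |X ω| ≤ C + |C|) →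
      (∀ ω, |Y ω| ≤ C + |C|) → (∀ ω ω', 0 ≤ (X ω - X ω') * (Y ω - Y ω')) →
      choquet (fun ω => X ω + Y ω) ν - choquet X ν - choquet Y ν = 0 by
    have hb : ∀ {Z : Ω → ℝ}, (∀ ω, |Z ω| ≤ C) → ∀ ω, abs (Z ω + |C|) ≤ C + |C| := fun hZ ω =>
      (abs_add_le _ _).trans (by rw [abs_abs]; gcongr; exact hZ ω)
    have hn : ∀ {Z : Ω → ℝ}, (∀ ω, |Z ω| ≤ C) → ∀ ω, 0 ≤ Z ω + |C| := fun hZ ω => by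
      linarith [(abs_le.1 (hZ ω)).1, le_abs_self C]
    have := h (fun ω => X ω + |C|) (fun ω => Y ω + |C|) (hn hX) (hn hY) (hb hX) (hb hY)
      (by simpa using hXY)
    rw [choquet_add_sub_shift hν hX hY] at this
    linarith
  clear hXY hX hY
  intro X Y hX0 hY0 hX hY hXY
  have key : ∀ n : ℕ, 0 < n →
      |n * (choquet (fun ω => X ω + Y ω) ν - choquet X ν - choquet Y ν)| ≤ 4 := by
    intro n hn
    obtain ⟨M, hM⟩ := exists_nat_floor_add_lt hX hY n
    set f : Ω → ℕ := fun ω => ⌊n * X ω⌋₊ with hf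
    set g : Ω → ℕ := fun ω => ⌊n * Y ω⌋₊ with hg
    have hcom : ∀ ω ω', (f ω ≤ f ω' ∧ g ω ≤ g ω') ∨ (f ω' ≤ f ω ∧ g ω' ≤ g ω) := by
      have hn' : (0 : ℝ) ≤ n := Nat.cast_nonneg n
      have hle : ∀ {x y : ℝ}, x ≤ y → ⌊n * x⌋₊ ≤ ⌊n * y⌋₊ := fun h =>
        Nat.floor_le_floor (mul_le_mul_of_nonneg_left h hn')
      intro ω ω'
      rcases mul_nonneg_iff.1 (hXY ω ω') with h | h
      · exact Or.inr ⟨hle (by linarith [h.1]), hle (by linarith [h.2])⟩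
      · exact Or.inl ⟨hle (by linarith [h.1]), hle (by linarith [h.2])⟩
    -- Upper level sets of comonotonic functions form a chain, and `f + min g i` is comonotonic with
    -- `g`.
    have hnest : ∀ i k : ℕ, {ω | k ≤ f ω + min (g ω) i} ⊆ {ω | i + 1 ≤ g ω} ∨
        {ω | i + 1 ≤ g ω} ⊆ {ω | k ≤ f ω + min (g ω) i} := by
      intro i k
      by_contra! h
      obtain ⟨⟨ω, h1, h2⟩, ω', h3, h4⟩ := And.imp not_subset.1 not_subset.1 h
      simp only [mem_ofPred_eq] at h1 h2 h3 h4
      rcases hcom ω ω' with h | h <;> omega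
    have l1 := layerSum_add_le hν.empty hM fun i => layerSubmodular_of_nested ν (hnest i)
    -- Applying the inequality to `-ν` reverses it, so the layer sums are exactly additive.
    have l2 := layerSum_add_le (ν := fun A => -ν A) (by simp [hν.empty]) hM
      fun i => layerSubmodular_of_nested _ (hnest i)
    simp only [layerSum_neg] at l2
    obtain ⟨a1, a2⟩ := nat_mul_choquet_floor_bounds hν hn hX0
      fun ω => (le_trans (Nat.le_add_right _ _) (hM ω).le)
    obtain ⟨b1, b2⟩ := nat_mul_choquet_floor_bounds hν hn hY0
      fun ω => (le_trans (Nat.le_add_left _ _) (hM ω).le)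
    obtain ⟨c1, c2⟩ := nat_mul_choquet_add_floor_bounds hν hn hX0 hY0 fun ω => (hM ω).le
    rw [abs_le]
    constructor <;> linarith
  apply le_antisymm
  · exact nonpos_of_forall_nat_mul_le fun n hn => (abs_le.1 (key n hn)).2
  · have := nonpos_of_forall_nat_mul_le (c := 4)
      (a := -(choquet (fun ω => X ω + Y ω) ν - choquet X ν - choquet Y ν))
      fun n hn => by linarith [(abs_le.1 (key n hn)).1]
    linarith

/-- For integer-valued functions this is `layerSum_add_le`, all layers being measurable. The three
roundings leave an error of at most `3`, uniformly in the scale `n`. -/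
theorem choquet_add_le [MeasurableSpace Ω] (hν : IsCapacity ν)
    (hsub : ∀ A B : Set Ω, MeasurableSet A → MeasurableSet B →
      ν (A ∪ B) + ν (A ∩ B) ≤ ν A + ν B)
    (hXm : Measurable X) (hYm : Measurable Y) {C : ℝ} (hX : ∀ ω, |X ω| ≤ C)
    (hY : ∀ ω, |Y ω| ≤ C) :
    choquet (fun ω => X ω + Y ω) ν ≤ choquet X ν + choquet Y ν := by
  suffices h : ∀ X Y : Ω → ℝ, Measurable X → Measurable Y → (∀ ω, 0 ≤ X ω) → (∀ ω, 0 ≤ Y ω) →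
      (∀ ω, |X ω| ≤ C + |C|) → (∀ ω, |Y ω| ≤ C + |C|) →
      choquet (fun ω => X ω + Y ω) ν - choquet X ν - choquet Y ν ≤ 0 by
    have hb : ∀ {Z : Ω → ℝ}, (∀ ω, |Z ω| ≤ C) → ∀ ω, abs (Z ω + |C|) ≤ C + |C| := fun hZ ω =>
      (abs_add_le _ _).trans (by rw [abs_abs]; gcongr; exact hZ ω)
    have hn : ∀ {Z : Ω → ℝ}, (∀ ω, |Z ω| ≤ C) → ∀ ω, 0 ≤ Z ω + |C| := fun hZ ω => by
      linarith [(abs_le.1 (hZ ω)).1, le_abs_self C]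
    have := h (fun ω => X ω + |C|) (fun ω => Y ω + |C|) (hXm.add_const _) (hYm.add_const _)
      (hn hX) (hn hY) (hb hX) (hb hY)
    rw [choquet_add_sub_shift hν hX hY] at this
    linarith
  clear hXm hYm hX hY
  intro X Y hXm hYm hX0 hY0 hX hY
  refine nonpos_of_forall_nat_mul_le (c := 3) fun n hn => ?_
  obtain ⟨M, hM⟩ := exists_nat_floor_add_lt hX hY n
  have hfm : Measurable fun ω => ⌊n * X ω⌋₊ := Nat.measurable_floor.comp (hXm.const_mul _)
  have hgm : Measurable fun ω => ⌊n * Y ω⌋₊ := Nat.measurable_floor.comp (hYm.const_mul _)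
  have l1 := layerSum_add_le hν.empty hM fun i k => by
    have hm : Measurable fun ω => ⌊n * X ω⌋₊ + min ⌊n * Y ω⌋₊ i :=
      hfm.add (hgm.min measurable_const)
    have hk : ∀ k : ℕ, MeasurableSet {ω | k ≤ ⌊n * X ω⌋₊ + min ⌊n * Y ω⌋₊ i} :=
      fun k => measurableSet_le measurable_const hm
    have hC : MeasurableSet {ω | i + 1 ≤ ⌊n * Y ω⌋₊} := measurableSet_le measurable_const hgm
    have := hsub _ _ (hk (k + 1)) ((hk k).inter hC)
    have hsucc : {ω | k + 1 ≤ ⌊n * X ω⌋₊ + min ⌊n * Y ω⌋₊ i} ⊆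
        {ω | k ≤ ⌊n * X ω⌋₊ + min ⌊n * Y ω⌋₊ i} := fun ω hω => Nat.le_of_succ_le hω
    rwa [← inter_assoc, inter_eq_self_of_subset_left hsucc] at this
  obtain ⟨a1, a2⟩ := nat_mul_choquet_floor_bounds hν hn hX0
    fun ω => (le_trans (Nat.le_add_right _ _) (hM ω).le)
  obtain ⟨b1, b2⟩ := nat_mul_choquet_floor_bounds hν hn hY0
    fun ω => (le_trans (Nat.le_add_left _ _) (hM ω).le)
  obtain ⟨c1, c2⟩ := nat_mul_choquet_add_floor_bounds hν hn hX0 hY0 fun ω => (hM ω).le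
  linarith

end Choquet

/-! ### Concavity and comparison of distortions on the unit interval -/

section RealFunctions

/-- The points `a` and `b` are convex combinations of `x` and `y` with exchanged weights; the two
concavity inequalities are added. -/
theorem add_le_add_of_concaveOn {h : ℝ → ℝ} {s : Set ℝ} (hh : ConcaveOn ℝ s h) {x y a b : ℝ}
    (hx : x ∈ s) (hy : y ∈ s) (hxa : x ≤ a) (hxb : x ≤ b) (hab : a + b = x + y) :
    h x + h y ≤ h a + h b := by
  rcases (show x ≤ y by linarith).eq_or_lt with rfl | hxy
  · have ha : a = x := by linarith
    have hb : b = x := by linarith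
    rw [ha, hb]
  have hd : 0 < y - x := sub_pos.2 hxy
  have ht0 : 0 ≤ (a - x) / (y - x) := div_nonneg (by linarith) hd.le
  have ht1 : 0 ≤ (b - x) / (y - x) := div_nonneg (by linarith) hd.le
  have ht : (b - x) / (y - x) + (a - x) / (y - x) = 1 := by
    rw [← add_div, div_eq_one_iff_eq hd.ne']
    linarith
  have h1 := hh.2 hx hy ht1 ht0 ht
  have h2 := hh.2 hx hy ht0 ht1 (by rw [add_comm, ht])
  simp only [smul_eq_mul] at h1 h2
  have e1 : (b - x) / (y - x) * x + (a - x) / (y - x) * y = a := by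
    field_simp
    linear_combination x * hab
  have e2 : (a - x) / (y - x) * x + (b - x) / (y - x) * y = b := by
    field_simp
    linear_combination x * hab
  rw [e1] at h1
  rw [e2] at h2
  have h3 : h x + h y = ((b - x) / (y - x) + (a - x) / (y - x)) * (h x + h y) := by
    rw [ht, one_mul]
  linarith

/-- A nondecreasing function on `[0, 1]` whose increments over intervals of equal length decrease
is concave. -/
theorem concaveOn_of_monotoneOn_of_increments {u : ℝ → ℝ} (hu : MonotoneOn u (Icc 0 1))
    (H : ∀ x y δ : ℝ, 0 ≤ x → x ≤ y → 0 ≤ δ → y + δ ≤ 1 → u x + u (y + δ) ≤ u (x + δ) + u y) :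
    ConcaveOn ℝ (Icc 0 1) u := by
  refine concaveOn_of_slope_anti_adjacent (convex_Icc 0 1) fun {x y z} hx hz hxy hyz => ?_
  have hd : 0 < z - y := sub_pos.2 hyz
  have he : 0 < y - x := sub_pos.2 hxy
  have hy : y ∈ Icc (0 : ℝ) 1 := ⟨hx.1.trans hxy.le, hyz.le.trans hz.2⟩
  rw [div_le_div_iff₀ hd he]
  suffices h : (u z - u y) * (y - x) - (u y - u x) * (z - y) ≤ 0 by linarith
  refine nonpos_of_forall_nat_mul_le (c := (z - y) * (u z - u y)) fun n hn => ?_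
  have hn' : (0 : ℝ) < n := Nat.cast_pos.2 hn
  -- The increment `I` over `[y, y + δ]` bounds those to its right from above and those to its left
  -- from below. The grid divides `[y, z]` exactly but `[x, y]` only up to one step, which
  -- monotonicity of `u` absorbs.
  set δ := (z - y) / n with hδ
  have hδ0 : 0 < δ := div_pos hd hn'
  have hnδ : n * δ = z - y := by
    rw [hδ]
    field_simp
  set I := u (y + δ) - u y with hI
  have up : ∀ k : ℕ, y + k * δ ≤ 1 → u (y + k * δ) - u y ≤ k * I := by
    intro k
    induction k with
    | zero => simp
    | succ k ih =>
      intro hk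
      push_cast at hk ⊢
      have hkδ : 0 ≤ k * δ := by positivity
      have h1 := H y (y + k * δ) δ hy.1 (by linarith) hδ0.le (by linarith)
      have h2 := ih (by linarith)
      rw [show y + (k + 1) * δ = y + k * δ + δ by ring]
      linarith
  have down : ∀ k : ℕ, 0 ≤ y - k * δ → k * I ≤ u y - u (y - k * δ) := by
    intro k
    induction k with
    | zero => simp
    | succ k ih =>
      intro hk
      push_cast at hk ⊢
      have hkδ : 0 ≤ k * δ := by positivity
      have hδn : δ ≤ n * δ := by
        have : (1 : ℝ) ≤ n := by exact_mod_cast hn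
        nlinarith
      have h1 := H (y - (k + 1) * δ) y δ hk (by linarith) hδ0.le (by linarith [hz.2])
      have h2 := ih (by linarith)
      rw [show y - (k + 1) * δ + δ = y - k * δ by ring] at h1
      linarith
  have h1 : u z - u y ≤ n * I := by
    have := up n (by rw [hnδ]; linarith [hz.2])
    rwa [hnδ, add_sub_cancel] at this
  set k := ⌊(y - x) / δ⌋₊ with hk
  have hkle : k * δ ≤ y - x := by
    rw [← le_div_iff₀ hδ0]
    exact Nat.floor_le (by positivity)
  have hklt : y - x < (k + 1) * δ := by
    rw [← div_lt_iff₀ hδ0]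
    exact Nat.lt_floor_add_one _
  have hkδ : 0 ≤ k * δ := by positivity
  have h2 : k * I ≤ u y - u x :=
    (down k (by linarith [hx.1])).trans
      (sub_le_sub_left (hu hx ⟨by linarith [hx.1], by linarith [hy.2]⟩ (by linarith)) _)
  have hE : 0 ≤ u z - u y := sub_nonneg.2 (hu hy hz hyz.le)
  have h3 : n * (y - x) ≤ (k + 1) * (z - y) := by
    rw [← hnδ]
    nlinarith
  have h4 : k * (u z - u y) ≤ n * (u y - u x) := by
    calc k * (u z - u y) ≤ k * (n * I) := by gcongr
      _ = n * (k * I) := by ring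
      _ ≤ n * (u y - u x) := by gcongr
  nlinarith [mul_le_mul_of_nonneg_right h3 hE, mul_le_mul_of_nonneg_right h4 hd.le]

/-- The inequality satisfied by the distortions of two mutually singular scenarios. -/
def MixtureDominated (u v : ℝ → ℝ) : Prop :=
  ∀ a b t : ℝ, a ∈ Icc (0 : ℝ) 1 → b ∈ Icc (0 : ℝ) 1 → t ∈ Icc (0 : ℝ) 1 →
    t * u a + (1 - t) * v b ≤
      t * u (t * a + (1 - t) * b) + (1 - t) * v (t * a + (1 - t) * b)

theorem MixtureDominated.symm {u v : ℝ → ℝ} (h : MixtureDominated u v) :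
    MixtureDominated v u := by
  intro a b t ha hb ht
  have := h b a (1 - t) hb ha ⟨by linarith [ht.2], by linarith [ht.1]⟩
  rw [sub_sub_cancel, add_comm ((1 - t) * b)] at this
  linarith

/-- On a grid of step `δ` from `z` to `1`, each increment of `u` is at most the preceding increment
of `v`. Summing gives `1 - u (z + δ) ≤ 1 - v z`, that is `v z ≤ u (z + δ)`, and a one-sided
Lipschitz bound for `u` at `z` lets `δ` tend to `0`. -/
theorem MixtureDominated.le {u v : ℝ → ℝ} (h : MixtureDominated u v)
    (hv : MonotoneOn v (Icc 0 1)) (u0 : u 0 = 0) (v0 : v 0 = 0)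
    (u1 : u 1 = 1) (v1 : v 1 = 1) {z : ℝ} (hz : z ∈ Icc (0 : ℝ) 1) : v z ≤ u z := by
  rcases hz.1.eq_or_lt with rfl | hz0
  · rw [u0, v0]
  rcases hz.2.eq_or_lt with rfl | hz1
  · rw [u1, v1]
  -- The choice `b = 0`, `t = z / a` puts the mixed probability at `z`.
  have lip : ∀ a, z ≤ a → a ≤ 1 → z * (u a - u z) ≤ a - z := by
    intro a hza ha
    have ha0 : 0 < a := hz0.trans_le hza
    have h1 := h a 0 (z / a) ⟨ha0.le, ha⟩ ⟨le_rfl, zero_le_one⟩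
      ⟨by positivity, (div_le_one ha0).2 hza⟩
    rw [mul_zero, add_zero, div_mul_cancel₀ _ ha0.ne', v0, mul_zero, add_zero] at h1
    have h2 : v z ≤ 1 := v1 ▸ hv hz ⟨zero_le_one, le_rfl⟩ hz.2
    have h3 : a * (z / a) = z := by field_simp
    have h4 : 0 ≤ 1 - z / a := sub_nonneg.2 ((div_le_one ha0).2 hza)
    have h5 : z / a * u a ≤ z / a * u z + (1 - z / a) := by nlinarith
    have h6 := mul_le_mul_of_nonneg_left h5 ha0.le
    have h7 : a * (z / a * u a) = z * u a := by rw [← mul_assoc, h3]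
    have h8 : a * (z / a * u z + (1 - z / a)) = z * u z + a - z := by
      linear_combination (u z - 1) * h3
    linarith
  -- With `t = 1 / 2` and `a - b = 2 * δ`, the midpoint is the common endpoint of an interval for
  -- `v` and the next interval for `u`.
  have chain : ∀ δ : ℝ, 0 ≤ δ → ∀ m : ℕ, z + (m + 1) * δ ≤ 1 →
      u (z + (m + 1) * δ) - u (z + δ) ≤ v (z + m * δ) - v z := by
    intro δ hδ m
    induction m with
    | zero => simp
    | succ m ih =>
      intro hm
      push_cast at hm ⊢
      have hmδ : 0 ≤ m * δ := by positivity
      have h1 := ih (by linarith)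
      have h2 := h (z + (m + 1 + 1) * δ) (z + m * δ) (1 / 2) ⟨by linarith, hm⟩
        ⟨by linarith, by linarith⟩ ⟨by norm_num, by norm_num⟩
      rw [show 1 / 2 * (z + (m + 1 + 1) * δ) + (1 - 1 / 2) * (z + m * δ)
        = z + (m + 1) * δ by ring] at h2
      linarith
  rw [← sub_nonpos]
  have hlim : z * (v z - u z) ≤ 0 := by
    refine nonpos_of_forall_nat_mul_le (c := 1 - z) fun n hn => ?_
    obtain ⟨m, rfl⟩ := Nat.exists_eq_add_one.2 hn
    have hn' : (0 : ℝ) < m + 1 := by positivity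
    push_cast
    set δ := (1 - z) / (m + 1) with hδ
    have hδ0 : 0 ≤ δ := div_nonneg (by linarith) hn'.le
    have hnδ : (m + 1) * δ = 1 - z := by
      rw [hδ]
      field_simp
    have hmδ : 0 ≤ m * δ := by positivity
    have h1 := chain δ hδ0 m (by linarith)
    rw [hnδ, add_sub_cancel, u1] at h1
    have h2 : v (z + m * δ) ≤ 1 :=
      v1 ▸ hv ⟨by linarith, by linarith⟩ ⟨zero_le_one, le_rfl⟩ (by linarith)
    have h3 := lip (z + δ) (by linarith) (by linarith)
    have h4 : z * (v z - u z) ≤ δ := by nlinarith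
    nlinarith
  nlinarith

theorem MixtureDominated.eqOn {u v : ℝ → ℝ} (h : MixtureDominated u v)
    (hu : MonotoneOn u (Icc 0 1)) (hv : MonotoneOn v (Icc 0 1)) (u0 : u 0 = 0) (v0 : v 0 = 0)
    (u1 : u 1 = 1) (v1 : v 1 = 1) : EqOn u v (Icc 0 1) := fun _ hz =>
  le_antisymm (h.symm.le hu v0 u0 v1 u1 hz) (h.le hv u0 v0 u1 v1 hz)

theorem MixtureDominated.concaveOn {u v : ℝ → ℝ} (h : MixtureDominated u v)
    (huv : EqOn u v (Icc 0 1)) : ConcaveOn ℝ (Icc 0 1) u := by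
  refine ⟨convex_Icc 0 1, fun a ha b hb s t hs ht hst => ?_⟩
  obtain rfl : t = 1 - s := by linarith
  have h1 := h a b s ha hb ⟨hs, by linarith⟩
  have hc := convex_Icc (0 : ℝ) 1 ha hb hs ht hst
  simp only [smul_eq_mul] at hc ⊢
  rw [← huv hb, ← huv hc] at h1
  linarith

end RealFunctions

/-! ### Atomless scenarios: level sets, conditioning, singularity -/

section Scenarios

variable {Ω : Type*} [MeasurableSpace Ω]

instance (P : Scenario Ω) : IsProbabilityMeasure P.measure := P.isProbabilityMeasure

theorem Scenario.eq_of_measure_eq {P Q : Scenario Ω} (h : P.measure = Q.measure) : P = Q := by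
  cases P
  cases Q
  cases h
  rfl

theorem Scenario.prob_mem_Icc (P : Scenario Ω) (A : Set Ω) : P.prob A ∈ Icc (0 : ℝ) 1 :=
  ⟨measureReal_nonneg, measureReal_le_one⟩

theorem Scenario.prob_mono (P : Scenario Ω) {A B : Set Ω} (h : A ⊆ B) : P.prob A ≤ P.prob B :=
  measureReal_mono h

theorem Scenario.prob_empty (P : Scenario Ω) : P.prob ∅ = 0 := measureReal_empty

theorem Scenario.prob_univ (P : Scenario Ω) : P.prob univ = 1 := probReal_univ

theorem Scenario.prob_mix (P Q : Scenario Ω) {t : ℝ} (ht : t ∈ Icc (0 : ℝ) 1) (A : Set Ω) :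
    (Scenario.mix t ht P Q).prob A = t * P.prob A + (1 - t) * Q.prob A := by
  simp only [Scenario.prob, Scenario.mix, Measure.real, Measure.coe_add, Measure.coe_smul,
    Pi.add_apply, Pi.smul_apply, smul_eq_mul]
  rw [ENNReal.toReal_add (by finiteness) (by finiteness), ENNReal.toReal_mul,
    ENNReal.toReal_mul, ENNReal.toReal_ofReal ht.1, ENNReal.toReal_ofReal (sub_nonneg.2 ht.2)]

/-- A random variable that is uniformly distributed on `[0, 1]` under `P`. -/
def Scenario.uniform (P : Scenario Ω) : Ω → ℝ := P.isAtomless.choose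

theorem Scenario.measurable_uniform (P : Scenario Ω) : Measurable P.uniform :=
  P.isAtomless.choose_spec.1

theorem Scenario.map_uniform (P : Scenario Ω) :
    P.measure.map P.uniform = volume.restrict (Icc (0 : ℝ) 1) :=
  P.isAtomless.choose_spec.2

/-- An event of probability `p ∈ [0, 1]` under `P`, increasing in `p`. -/
def Scenario.levelSet (P : Scenario Ω) (p : ℝ) : Set Ω := P.uniform ⁻¹' Iic p

theorem Scenario.measurableSet_levelSet (P : Scenario Ω) (p : ℝ) :
    MeasurableSet (P.levelSet p) := P.measurable_uniform measurableSet_Iic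

theorem Scenario.levelSet_mono (P : Scenario Ω) {p q : ℝ} (h : p ≤ q) :
    P.levelSet p ⊆ P.levelSet q := preimage_mono (Iic_subset_Iic.2 h)

theorem Scenario.prob_levelSet (P : Scenario Ω) {p : ℝ} (hp : p ∈ Icc (0 : ℝ) 1) :
    P.prob (P.levelSet p) = p := by
  have h : Iic p ∩ Icc (0 : ℝ) 1 = Icc 0 p := by
    ext x
    simp only [mem_inter_iff, mem_Iic, mem_Icc]
    exact ⟨fun h => ⟨h.2.1, h.1⟩, fun h => ⟨h.2, h.1, h.2.trans hp.2⟩⟩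
  rw [Scenario.prob, Measure.real, Scenario.levelSet,
    ← Measure.map_apply P.measurable_uniform measurableSet_Iic, P.map_uniform,
    Measure.restrict_apply measurableSet_Iic, h, Real.volume_Icc, sub_zero,
    ENNReal.toReal_ofReal hp.1]

/-- A probability measure that is absolutely continuous with respect to an atomless one is
atomless. -/
theorem IsAtomless.of_absolutelyContinuous {μ ν : Measure Ω} [IsProbabilityMeasure μ]
    (hν : IsAtomless ν) (h : μ ≪ ν) : IsAtomless μ := by
  obtain ⟨U, hU, hUν⟩ := hν
  have : IsProbabilityMeasure (μ.map U) := Measure.isProbabilityMeasure_map hU.aemeasurable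
  have : NullSingletonClass (μ.map U) := ⟨fun x => by
    rw [Measure.map_apply hU (measurableSet_singleton x)]
    exact h (measure_preimage_singleton_of_uniform hU hUν x)⟩
  have hF : Measurable (ProbabilityTheory.cdf (μ.map U)) :=
    (ProbabilityTheory.monotone_cdf _).measurable
  exact ⟨fun ω => ProbabilityTheory.cdf (μ.map U) (U ω), hF.comp hU,
    (Measure.map_map hF hU).symm.trans (map_cdf_eq_uniform _)⟩

/-- The conditional scenario `P(· | B)`. -/
def Scenario.cond (P : Scenario Ω) (B : Set Ω) (hB : P.measure B ≠ 0) : Scenario Ω :=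
  have := ProbabilityTheory.cond_isProbabilityMeasure hB
  { measure := ProbabilityTheory.cond P.measure B
    isProbabilityMeasure := this
    isAtomless := P.isAtomless.of_absolutelyContinuous
      ProbabilityTheory.cond_absolutelyContinuous }

theorem Scenario.cond_prob_of_disjoint (P : Scenario Ω) {B C : Set Ω} (hB : P.measure B ≠ 0)
    (hBm : MeasurableSet B) (h : Disjoint B C) : (P.cond B hB).prob C = 0 := by
  simp [Scenario.prob, Scenario.cond, Measure.real, ProbabilityTheory.cond_apply hBm,
    h.inter_eq]

theorem Scenario.mix_cond_compl (P : Scenario Ω) {B : Set Ω} (hBm : MeasurableSet B)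
    (hB : P.measure B ≠ 0) (hB' : P.measure Bᶜ ≠ 0) :
    Scenario.mix (P.prob B) (P.prob_mem_Icc B) (P.cond B hB) (P.cond Bᶜ hB') = P := by
  refine Scenario.eq_of_measure_eq (Measure.ext fun s _ => ?_)
  have h1 : ENNReal.ofReal (P.prob B) = P.measure B := ofReal_measureReal
  have h2 : ENNReal.ofReal (1 - P.prob B) = P.measure Bᶜ := by
    rw [Scenario.prob, ← probReal_compl_eq_one_sub hBm]
    exact ofReal_measureReal
  simp only [Scenario.mix, Scenario.cond, Measure.coe_add, Measure.coe_smul, Pi.add_apply,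
    Pi.smul_apply, smul_eq_mul, h1, h2]
  rw [mul_comm, mul_comm (P.measure Bᶜ)]
  exact ProbabilityTheory.cond_add_cond_compl_eq hBm P.measure

/-- Mutually singular scenarios can be prescribed independently on a common event. -/
theorem exists_prob_eq_of_singular {P Q : Scenario Ω} {B : Set Ω} (hBm : MeasurableSet B)
    (hP : P.prob Bᶜ = 0) (hQ : Q.prob B = 0) {a b : ℝ} (ha : a ∈ Icc (0 : ℝ) 1)
    (hb : b ∈ Icc (0 : ℝ) 1) : ∃ A, MeasurableSet A ∧ P.prob A = a ∧ Q.prob A = b := by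
  -- `P` lives on `B` and `Q` on `Bᶜ`, so a level set of each is glued along `B`.
  refine ⟨P.levelSet a ∩ B ∪ Q.levelSet b ∩ Bᶜ,
    ((P.measurableSet_levelSet a).inter hBm).union
      ((Q.measurableSet_levelSet b).inter hBm.compl), ?_, ?_⟩
  · nth_rw 2 [← P.prob_levelSet ha]
    refine measureReal_congr ?_
    have h0 : ∀ᵐ ω ∂P.measure, ω ∈ B := by
      rw [ae_iff]
      exact (measureReal_eq_zero_iff).1 hP
    filter_upwards [h0] with ω hω
    refine propext ?_
    change (ω ∈ P.levelSet a ∩ B ∪ Q.levelSet b ∩ Bᶜ) ↔ ω ∈ P.levelSet a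
    simp [hω]
  · nth_rw 2 [← Q.prob_levelSet hb]
    refine measureReal_congr ?_
    have h0 : ∀ᵐ ω ∂Q.measure, ω ∉ B := by
      rw [ae_iff]
      simpa using (measureReal_eq_zero_iff).1 hQ
    filter_upwards [h0] with ω hω
    refine propext ?_
    change (ω ∈ P.levelSet a ∩ B ∪ Q.levelSet b ∩ Bᶜ) ↔ ω ∈ Q.levelSet b
    simp [hω]

theorem sameLaw_indicatorRV {P Q : Scenario Ω} {A B : Set Ω} (hA : MeasurableSet A)
    (hB : MeasurableSet B) (h : P.prob A = Q.prob B) :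
    SameLaw (indicatorRV A hA) P (indicatorRV B hB) Q := by
  have hAB : P.measure A = Q.measure B := (measureReal_eq_measureReal_iff).1 h
  have hc : P.measure Aᶜ = Q.measure Bᶜ := by
    rw [prob_compl_eq_one_sub hA, prob_compl_eq_one_sub hB, hAB]
  refine Measure.ext fun s hs => ?_
  rw [Measure.map_apply (indicatorRV A hA).2.1 hs, Measure.map_apply (indicatorRV B hB).2.1 hs]
  have hpre : ∀ (C : Set Ω) (hC : MeasurableSet C), (indicatorRV C hC : Ω → ℝ) ⁻¹' s
      = {ω | (ω ∈ C ∧ (1 : ℝ) ∈ s) ∨ (ω ∉ C ∧ (0 : ℝ) ∈ s)} := by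
    intro C hC
    ext ω
    by_cases hω : ω ∈ C <;> simp [indicatorRV, hω]
  rw [hpre, hpre]
  by_cases h1 : (1 : ℝ) ∈ s <;> by_cases h0 : (0 : ℝ) ∈ s
  · simp [h1, h0, em]
  · simpa [h1, h0] using hAB
  · simpa [h1, h0, compl_def] using hc
  · simp [h1, h0]

end Scenarios

/-! ### Choquet representation of comonotonic additive functionals -/

section Representation

variable {Ω : Type*} [MeasurableSpace Ω]

/-- The truncation at `M` of a random variable with values in `ℕ`. -/
def natRV (f : Ω → ℕ) (hf : Measurable f) (M : ℕ) : BoundedRV Ω :=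
  ⟨fun ω => ((min (f ω) M : ℕ) : ℝ), measurable_from_top.comp (hf.min measurable_const), M,
    fun ω => by
      rw [Nat.abs_cast, Nat.cast_le]
      exact min_le_right _ _⟩

theorem natRV_zero (f : Ω → ℕ) (hf : Measurable f) : natRV f hf 0 = 0 := by
  ext ω
  simp [natRV]

theorem natRV_succ (f : Ω → ℕ) (hf : Measurable f) (M : ℕ) :
    natRV f hf (M + 1) = natRV f hf M +
      indicatorRV {ω | M + 1 ≤ f ω} (measurableSet_le measurable_const hf) := by
  ext ω
  change ((min (f ω) (M + 1) : ℕ) : ℝ)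
    = ((min (f ω) M : ℕ) : ℝ) + {ω | M + 1 ≤ f ω}.indicator (fun _ => (1 : ℝ)) ω
  by_cases h : M + 1 ≤ f ω
  · rw [indicator_of_mem (show ω ∈ {ω | M + 1 ≤ f ω} from h), min_eq_right h,
      min_eq_right (Nat.le_of_succ_le h)]
    push_cast
    rfl
  · rw [indicator_of_notMem (show ω ∉ {ω | M + 1 ≤ f ω} from h), add_zero,
      min_eq_left (by omega), min_eq_left (by omega)]

theorem comonotonic_natRV_indicatorRV (f : Ω → ℕ) (hf : Measurable f) (M : ℕ) :
    Comonotonic (natRV f hf M)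
      (indicatorRV {ω | M + 1 ≤ f ω} (measurableSet_le measurable_const hf)) := by
  have h1 : ∀ ω ω', f ω ≤ f ω' → (natRV f hf M).1 ω ≤ (natRV f hf M).1 ω' := by
    intro ω ω' h
    exact Nat.cast_le.2 (min_le_min_right M h)
  have h2 : ∀ ω ω', f ω ≤ f ω' → {ω | M + 1 ≤ f ω}.indicator (fun _ => (1 : ℝ)) ω ≤
      {ω | M + 1 ≤ f ω}.indicator (fun _ => (1 : ℝ)) ω' := by
    intro ω ω' h
    by_cases hω : M + 1 ≤ f ω
    · rw [indicator_of_mem (show ω ∈ {ω | M + 1 ≤ f ω} from hω),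
        indicator_of_mem (show ω' ∈ {ω | M + 1 ≤ f ω} from hω.trans h)]
    · rw [indicator_of_notMem (show ω ∉ {ω | M + 1 ≤ f ω} from hω)]
      exact indicator_nonneg (fun _ _ => zero_le_one) _
  intro ω ω'
  rcases le_total (f ω) (f ω') with h | h
  · exact mul_nonneg_of_nonpos_of_nonpos (sub_nonpos.2 (h1 _ _ h)) (sub_nonpos.2 (h2 _ _ h))
  · exact mul_nonneg (sub_nonneg.2 (h1 _ _ h)) (sub_nonneg.2 (h2 _ _ h))

/-- A monotone, cash-additive and comonotonic additive functional is the Choquet integral with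
respect to its values on indicators. -/
theorem eq_choquet_of_comonotonic_additive {φ : BoundedRV Ω → ℝ}
    (mono : ∀ X Y : BoundedRV Ω, (∀ ω, X.1 ω ≤ Y.1 ω) → φ X ≤ φ Y)
    (cash : ∀ (X : BoundedRV Ω) (m : ℝ), φ (X + constRV Ω m) = φ X + m)
    (com : ∀ X Y : BoundedRV Ω, Comonotonic X Y → φ (X + Y) = φ X + φ Y)
    {ν : Set Ω → ℝ} (hν : IsCapacity ν)
    (ind : ∀ (A : Set Ω) (hA : MeasurableSet A), φ (indicatorRV A hA) = ν A)
    (X : BoundedRV Ω) : φ X = choquet X.1 ν := by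
  have zero : φ 0 = 0 := by
    have := com 0 0 fun ω ω' => by simp
    rw [add_zero] at this
    linarith
  -- Positive homogeneity is not assumed; integer multiples suffice, since `n X` is comonotonic with
  -- `X`.
  have smul : ∀ (X : BoundedRV Ω) (n : ℕ), φ ((n : ℝ) • X) = n * φ X := by
    intro X n
    induction n with
    | zero => simp [zero]
    | succ n ih =>
      rw [Nat.cast_succ, add_smul, one_smul, com, ih]
      · ring
      · intro ω ω'
        change 0 ≤ (n * X.1 ω - n * X.1 ω') * (X.1 ω - X.1 ω')
        rw [← mul_sub, mul_assoc]
        exact mul_nonneg (Nat.cast_nonneg n) (mul_self_nonneg _)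
  have nat : ∀ (f : Ω → ℕ) (hf : Measurable f) (M : ℕ),
      φ (natRV f hf M) = layerSum ν M f := by
    intro f hf M
    induction M with
    | zero => simp [natRV_zero, zero, layerSum]
    | succ M ih =>
      rw [natRV_succ, com _ _ (comonotonic_natRV_indicatorRV f hf M), ih, ind, layerSum,
        layerSum, Finset.sum_range_succ]
  have nonneg : ∀ X : BoundedRV Ω, (∀ ω, 0 ≤ X.1 ω) → φ X = choquet X.1 ν := by
    intro X hX0
    obtain ⟨C, hC⟩ := X.2.2
    have key : ∀ n : ℕ, 0 < n → |n * (φ X - choquet X.1 ν)| ≤ 2 := by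
      intro n hn
      obtain ⟨M, hM⟩ := exists_nat_floor_add_lt hC hC n
      have hf : Measurable fun ω => ⌊n * X.1 ω⌋₊ := Nat.measurable_floor.comp (X.2.1.const_mul _)
      have hM' : ∀ ω, ⌊n * X.1 ω⌋₊ ≤ M := fun ω =>
        le_trans (Nat.le_add_right _ _) (hM ω).le
      have hmin : ∀ ω, (natRV _ hf M).1 ω = ⌊n * X.1 ω⌋₊ := fun ω =>
        congrArg Nat.cast (min_eq_left (hM' ω))
      obtain ⟨a1, a2⟩ := nat_mul_choquet_floor_bounds hν hn hX0 hM'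
      have b1 := mono (natRV _ hf M) ((n : ℝ) • X) fun ω => by
        rw [hmin]
        exact Nat.floor_le (mul_nonneg (Nat.cast_nonneg _) (hX0 ω))
      have b2 := mono ((n : ℝ) • X) (natRV _ hf M + constRV Ω 1) fun ω => by
        change n * X.1 ω ≤ (natRV _ hf M).1 ω + 1
        rw [hmin]
        exact (Nat.lt_floor_add_one _).le
      rw [smul, nat] at b1
      rw [cash, smul, nat] at b2
      rw [abs_le]
      constructor <;> linarith
    apply le_antisymm
    · have := nonpos_of_forall_nat_mul_le fun n hn => (abs_le.1 (key n hn)).2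
      linarith
    · have := nonpos_of_forall_nat_mul_le (c := 2) (a := -(φ X - choquet X.1 ν))
        fun n hn => by linarith [(abs_le.1 (key n hn)).1]
      linarith
  obtain ⟨C, hC⟩ := X.2.2
  have h1 := nonneg (X + constRV Ω C) fun ω => by
    change 0 ≤ X.1 ω + C
    linarith [(abs_le.1 (hC ω)).1]
  have h2 : choquet (X + constRV Ω C).1 ν = choquet X.1 ν + C := choquet_add_const hν hC C
  rw [cash, h2] at h1
  linarith

end Representation

/-! ### The distortion of a core and the three conditions -/

section Distortion

variable {Ω : Type*} [MeasurableSpace Ω] {Ψ : Core Ω}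

/-- The risk `Ψ(1_A | P)` of an event `A` of probability `p`. -/
def Core.distortion (Ψ : Core Ω) (P : Scenario Ω) (p : ℝ) : ℝ :=
  Ψ (indicatorRV (P.levelSet p) (P.measurableSet_levelSet p)) P

theorem Core.LossLawInvariant.indicatorRV_eq (hL : Ψ.LossLawInvariant) (P : Scenario Ω)
    {A : Set Ω} (hA : MeasurableSet A) :
    Ψ (indicatorRV A hA) P = Ψ.distortion P (P.prob A) :=
  hL _ _ P (sameLaw_indicatorRV hA _ (P.prob_levelSet (P.prob_mem_Icc A)).symm)

theorem indicatorRV_mono {A B : Set Ω} (hA : MeasurableSet A) (hB : MeasurableSet B)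
    (h : A ⊆ B) (ω : Ω) : (indicatorRV A hA).1 ω ≤ (indicatorRV B hB).1 ω :=
  indicator_le_indicator_of_subset h (fun _ => zero_le_one) ω

theorem Core.IsMonotone.monotone_distortion (hM : Ψ.IsMonotone) (P : Scenario Ω) :
    Monotone (Ψ.distortion P) := fun _ _ h =>
  hM P _ _ (indicatorRV_mono _ _ (P.levelSet_mono h))

theorem Core.ComonotonicAdditive.map_zero (hC : Ψ.ComonotonicAdditive) (P : Scenario Ω) :
    Ψ 0 P = 0 := by
  have := hC P 0 0 fun ω ω' => by simp
  rw [add_zero] at this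
  linarith

theorem Core.distortion_zero (hL : Ψ.LossLawInvariant) (hC : Ψ.ComonotonicAdditive)
    (P : Scenario Ω) : Ψ.distortion P 0 = 0 := by
  have h : indicatorRV ∅ MeasurableSet.empty = (0 : BoundedRV Ω) := by
    ext ω
    simp [indicatorRV]
  have h0 := hL.indicatorRV_eq P MeasurableSet.empty
  rwa [P.prob_empty, h, hC.map_zero, eq_comm] at h0

theorem Core.distortion_one (hL : Ψ.LossLawInvariant) (hA : Ψ.CashAdditive)
    (hC : Ψ.ComonotonicAdditive) (P : Scenario Ω) : Ψ.distortion P 1 = 1 := by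
  have h : indicatorRV univ MeasurableSet.univ = (0 : BoundedRV Ω) + constRV Ω 1 := by
    ext ω
    simp [indicatorRV, constRV]
  rw [← P.prob_univ, ← hL.indicatorRV_eq P MeasurableSet.univ, h, hA, hC.map_zero,
    P.prob_univ, zero_add]

/-- A law-invariant, monetary and comonotonic additive core is a distorted Choquet integral under
each scenario. -/
theorem Core.eq_choquet_distortion (hL : Ψ.LossLawInvariant) (hM : Ψ.Monetary)
    (hC : Ψ.ComonotonicAdditive) (X : BoundedRV Ω) (P : Scenario Ω) :
    Ψ X P = choquet X.1 fun A => Ψ.distortion P (P.prob A) :=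
  eq_choquet_of_comonotonic_additive (φ := fun X => Ψ X P) (hM.1 P) (hM.2 P) (hC P)
    { mono := fun _ _ h => hM.1.monotone_distortion P (P.prob_mono h)
      empty := by rw [P.prob_empty, distortion_zero hL hC]
      univ := by rw [P.prob_univ, distortion_one hL hM.2 hC] }
    (fun _ hA => hL.indicatorRV_eq P hA) X

/-- If the distortions do not depend on the scenario and are concave, then the core has a
representation by one concave distortion. -/
theorem Core.exists_isConcaveDistortion (hL : Ψ.LossLawInvariant) (hM : Ψ.Monetary)
    (hC : Ψ.ComonotonicAdditive)
    (hconc : ∀ P, ConcaveOn ℝ (Icc 0 1) (Ψ.distortion P))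
    (heq : ∀ P Q, EqOn (Ψ.distortion P) (Ψ.distortion Q) (Icc 0 1)) :
    ∃ h : ℝ → ℝ, IsConcaveDistortion h ∧ ∀ (X : BoundedRV Ω) (P : Scenario Ω),
      Ψ X P = choquet X.1 (fun A => h (P.prob A)) := by
  rcases isEmpty_or_nonempty (Scenario Ω) with hΩ | ⟨⟨P⟩⟩
  -- Without scenarios the representation is vacuous and any distortion serves.
  · exact ⟨id, ⟨mapsTo_id _, monotoneOn_id, concaveOn_id (convex_Icc 0 1), rfl, rfl⟩,
      fun _ P => hΩ.elim P⟩
  · have hm := hM.1.monotone_distortion P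
    have h0 := distortion_zero hL hC P
    have h1 := distortion_one hL hM.2 hC P
    refine ⟨Ψ.distortion P, ⟨fun p hp => ⟨?_, ?_⟩, hm.monotoneOn _, hconc P, h0, h1⟩,
      fun X Q => ?_⟩
    · rw [← h0]
      exact hm hp.1
    · rw [← h1]
      exact hm hp.2
    · rw [eq_choquet_distortion hL hM hC]
      congr 1
      funext A
      exact heq Q P (Q.prob_mem_Icc A)

/-! ### Ambiguity sensitive cores -/

/-- An event with probabilities `a` and `b` bounds the mixture's distortion at `t * a + (1 - t) * b`
from below. An event with that same probability under both `P` and `Q` evaluates it exactly. -/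
theorem Core.AmbiguitySensitive.mixtureDominated (hS : Ψ.AmbiguitySensitive)
    (hL : Ψ.LossLawInvariant) {P Q : Scenario Ω} {B : Set Ω} (hBm : MeasurableSet B)
    (hP : P.prob Bᶜ = 0) (hQ : Q.prob B = 0) :
    MixtureDominated (Ψ.distortion P) (Ψ.distortion Q) := by
  intro a b t ha hb ht
  have hp : t * a + (1 - t) * b ∈ Icc (0 : ℝ) 1 :=
    convex_Icc (0 : ℝ) 1 ha hb ht.1 (sub_nonneg.2 ht.2) (add_sub_cancel _ _)
  obtain ⟨A, hA, hPA, hQA⟩ := exists_prob_eq_of_singular hBm hP hQ ha hb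
  obtain ⟨D, hD, hPD, hQD⟩ := exists_prob_eq_of_singular hBm hP hQ hp hp
  have h1 := hS.1 (indicatorRV A hA) P Q t ht
  have h2 := hS.2 D hD P Q t ht (hPD.trans hQD.symm)
  rw [hL.indicatorRV_eq, hL.indicatorRV_eq, hL.indicatorRV_eq, Scenario.prob_mix, hPA, hQA] at h1
  rw [hL.indicatorRV_eq, hL.indicatorRV_eq, hL.indicatorRV_eq, Scenario.prob_mix, hPD, hQD,
    ← add_mul, add_sub_cancel, one_mul] at h2
  exact h1.trans_eq h2

theorem Core.AmbiguitySensitive.eqOn_of_singular (hS : Ψ.AmbiguitySensitive)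
    (hL : Ψ.LossLawInvariant) (hM : Ψ.Monetary) (hC : Ψ.ComonotonicAdditive)
    {P Q : Scenario Ω} {B : Set Ω} (hBm : MeasurableSet B)
    (hP : P.prob Bᶜ = 0) (hQ : Q.prob B = 0) :
    EqOn (Ψ.distortion P) (Ψ.distortion Q) (Icc 0 1) :=
  (hS.mixtureDominated hL hBm hP hQ).eqOn ((hM.1.monotone_distortion P).monotoneOn _)
    ((hM.1.monotone_distortion Q).monotoneOn _) (distortion_zero hL hC P)
    (distortion_zero hL hC Q) (distortion_one hL hM.2 hC P) (distortion_one hL hM.2 hC Q)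

/-- `P` is a mixture of the singular scenarios `P(· | B)` and `P(· | Bᶜ)`, whose distortions agree.
The exact half of ambiguity sensitivity, on an event of probability `p` under both, passes the
common value to `P`. -/
theorem Core.AmbiguitySensitive.distortion_cond (hS : Ψ.AmbiguitySensitive)
    (hL : Ψ.LossLawInvariant) (hM : Ψ.Monetary) (hC : Ψ.ComonotonicAdditive)
    (P : Scenario Ω) {B : Set Ω} (hBm : MeasurableSet B) (hB : P.measure B ≠ 0)
    (hB' : P.measure Bᶜ ≠ 0) :
    EqOn (Ψ.distortion P) (Ψ.distortion (P.cond B hB)) (Icc 0 1) ∧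
      ConcaveOn ℝ (Icc 0 1) (Ψ.distortion (P.cond B hB)) := by
  have h1 := P.cond_prob_of_disjoint hB hBm disjoint_compl_right
  have h2 := P.cond_prob_of_disjoint hB' hBm.compl disjoint_compl_left
  have he := hS.eqOn_of_singular hL hM hC hBm h1 h2
  refine ⟨fun p hp => ?_, (hS.mixtureDominated hL hBm h1 h2).concaveOn he⟩
  obtain ⟨D, hD, hPD, hQD⟩ := exists_prob_eq_of_singular hBm h1 h2 hp hp
  have h := hS.2 D hD _ _ (P.prob B) (P.prob_mem_Icc B) (hPD.trans hQD.symm)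
  rw [hL.indicatorRV_eq, hL.indicatorRV_eq, hL.indicatorRV_eq, Scenario.prob_mix, hPD, hQD,
    P.mix_cond_compl hBm hB hB', ← he hp, ← add_mul, ← add_mul, add_sub_cancel, one_mul,
    one_mul] at h
  exact h

theorem Scenario.measure_levelSet_half_ne_zero (P : Scenario Ω) :
    P.measure (P.levelSet (1 / 2)) ≠ 0 ∧ P.measure (P.levelSet (1 / 2))ᶜ ≠ 0 := by
  have h := P.prob_levelSet (p := 1 / 2) ⟨by norm_num, by norm_num⟩
  have h' : P.prob (P.levelSet (1 / 2))ᶜ = 1 / 2 := by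
    rw [Scenario.prob, probReal_compl_eq_one_sub (P.measurableSet_levelSet _), ← Scenario.prob, h]
    norm_num
  constructor <;> intro h0
  · rw [Scenario.prob, Measure.real, h0] at h
    norm_num at h
  · rw [Scenario.prob, Measure.real, h0] at h'
    norm_num at h'

theorem Core.AmbiguitySensitive.concaveOn_distortion (hS : Ψ.AmbiguitySensitive)
    (hL : Ψ.LossLawInvariant) (hM : Ψ.Monetary) (hC : Ψ.ComonotonicAdditive)
    (P : Scenario Ω) : ConcaveOn ℝ (Icc 0 1) (Ψ.distortion P) := by
  obtain ⟨h1, h2⟩ := P.measure_levelSet_half_ne_zero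
  obtain ⟨he, hc⟩ := hS.distortion_cond hL hM hC P (P.measurableSet_levelSet _) h1 h2
  exact hc.congr he.symm

theorem Core.AmbiguitySensitive.distortion_eqOn (hS : Ψ.AmbiguitySensitive)
    (hL : Ψ.LossLawInvariant) (hM : Ψ.Monetary) (hC : Ψ.ComonotonicAdditive)
    (P Q : Scenario Ω) : EqOn (Ψ.distortion P) (Ψ.distortion Q) (Icc 0 1) := by
  -- `P(· | B)` is singular to `Q(· | Bᶜ)`, or to `Q` itself when `Q` does not charge `B`.
  have key : ∀ B : Set Ω, MeasurableSet B → P.measure B ≠ 0 → P.measure Bᶜ ≠ 0 →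
      Q.measure Bᶜ ≠ 0 → EqOn (Ψ.distortion P) (Ψ.distortion Q) (Icc 0 1) := by
    intro B hBm hB hB' hQ
    refine (hS.distortion_cond hL hM hC P hBm hB hB').1.trans ?_
    have h1 := P.cond_prob_of_disjoint hB hBm disjoint_compl_right
    by_cases hQB : Q.measure B = 0
    · exact hS.eqOn_of_singular hL hM hC hBm h1 (by simp [Scenario.prob, Measure.real, hQB])
    · have h2 := Q.cond_prob_of_disjoint hQ hBm.compl disjoint_compl_left
      refine (hS.eqOn_of_singular hL hM hC hBm h1 h2).trans ?_
      exact (hS.distortion_cond hL hM hC Q hBm.compl hQ (by rwa [compl_compl])).1.symm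
  have hBm := P.measurableSet_levelSet (1 / 2)
  obtain ⟨h1, h2⟩ := P.measure_levelSet_half_ne_zero
  -- `B` and `Bᶜ` both have probability `1 / 2` under `P`, so they may be exchanged if `Q` does not
  -- charge `Bᶜ`.
  by_cases hQ : Q.measure (P.levelSet (1 / 2))ᶜ = 0
  · refine key _ hBm.compl h2 (by rwa [compl_compl]) ?_
    rw [compl_compl]
    intro h0
    have := prob_add_prob_compl (μ := Q.measure) hBm
    rw [h0, hQ, add_zero] at this
    exact zero_ne_one this
  · exact key _ hBm h1 h2 hQ

/-! ### Coherent cores -/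

theorem Core.LossLawInvariant.of_strongly (hL : Ψ.StronglyLawInvariant) :
    Ψ.LossLawInvariant := fun X Y P => hL X Y P P

theorem Core.StronglyLawInvariant.distortion_eqOn (hL : Ψ.StronglyLawInvariant)
    (P Q : Scenario Ω) : EqOn (Ψ.distortion P) (Ψ.distortion Q) (Icc 0 1) := fun _ hp =>
  hL _ _ P Q (sameLaw_indicatorRV _ _ ((P.prob_levelSet hp).trans (Q.prob_levelSet hp).symm))

theorem comonotonic_indicatorRV {A B : Set Ω} (hA : MeasurableSet A) (hB : MeasurableSet B)
    (h : A ⊆ B) : Comonotonic (indicatorRV A hA) (indicatorRV B hB) := by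
  intro ω ω'
  change 0 ≤ (A.indicator (fun _ => (1 : ℝ)) ω - A.indicator (fun _ => (1 : ℝ)) ω')
    * (B.indicator (fun _ => (1 : ℝ)) ω - B.indicator (fun _ => (1 : ℝ)) ω')
  have h1 := @h ω
  have h2 := @h ω'
  by_cases a : ω ∈ A <;> by_cases a' : ω' ∈ A <;> by_cases b : ω ∈ B <;>
    by_cases b' : ω' ∈ B <;> simp_all

/-- The nested indicators of `A ∩ B` and `A ∪ B` are comonotonic and have the same sum as those of
`A` and `B`. -/
theorem Core.indicatorRV_submodular (hS : Ψ.Subadditive) (hC : Ψ.ComonotonicAdditive)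
    (P : Scenario Ω) {A B : Set Ω} (hA : MeasurableSet A) (hB : MeasurableSet B) :
    Ψ (indicatorRV (A ∩ B) (hA.inter hB)) P + Ψ (indicatorRV (A ∪ B) (hA.union hB)) P ≤
      Ψ (indicatorRV A hA) P + Ψ (indicatorRV B hB) P := by
  rw [← hC P _ _ (comonotonic_indicatorRV _ _
    (inter_subset_left.trans subset_union_left))]
  refine le_trans (le_of_eq ?_) (hS P _ _)
  congr 1
  ext ω
  change (A ∩ B).indicator (fun _ => (1 : ℝ)) ω + (A ∪ B).indicator (fun _ => (1 : ℝ)) ω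
    = A.indicator (fun _ => (1 : ℝ)) ω + B.indicator (fun _ => (1 : ℝ)) ω
  rw [add_comm]
  exact congrFun (indicator_union_add_inter (fun _ => (1 : ℝ)) A B) ω

theorem Core.concaveOn_distortion_of_subadditive (hL : Ψ.LossLawInvariant) (hM : Ψ.IsMonotone)
    (hS : Ψ.Subadditive) (hC : Ψ.ComonotonicAdditive) (P : Scenario Ω) :
    ConcaveOn ℝ (Icc 0 1) (Ψ.distortion P) := by
  refine concaveOn_of_monotoneOn_of_increments ((hM.monotone_distortion P).monotoneOn _) ?_
  intro x y δ hx hxy hδ hy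
  have px := P.prob_levelSet (p := x) ⟨hx, by linarith⟩
  have pxδ := P.prob_levelSet (p := x + δ) ⟨by linarith, by linarith⟩
  have pyδ := P.prob_levelSet (p := y + δ) ⟨by linarith, hy⟩
  have mx := P.measurableSet_levelSet x
  have mxδ := P.measurableSet_levelSet (x + δ)
  have myδ := P.measurableSet_levelSet (y + δ)
  have s1 : P.levelSet x ⊆ P.levelSet (x + δ) := P.levelSet_mono (by linarith)
  have s2 : P.levelSet (x + δ) ⊆ P.levelSet (y + δ) := P.levelSet_mono (by linarith)
  -- The second event is chosen to have probability `y`, while the intersection and union are the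
  -- level sets at `x` and `y + δ`.
  have h := indicatorRV_submodular hS hC P mxδ (mx.union (myδ.diff mxδ))
  have hi : P.levelSet (x + δ) ∩ (P.levelSet x ∪ P.levelSet (y + δ) \ P.levelSet (x + δ))
      = P.levelSet x := by
    rw [inter_union_distrib_left, inter_sdiff_self, union_empty, inter_eq_self_of_subset_right s1]
  have hu : P.levelSet (x + δ) ∪ (P.levelSet x ∪ P.levelSet (y + δ) \ P.levelSet (x + δ))
      = P.levelSet (y + δ) := by
    rw [← union_assoc, union_eq_self_of_subset_right s1, union_sdiff_cancel s2]
  have hd : P.prob (P.levelSet x ∪ P.levelSet (y + δ) \ P.levelSet (x + δ)) = y := by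
    rw [Scenario.prob, measureReal_union (disjoint_sdiff_right.mono_left s1) (myδ.diff mxδ),
      measureReal_sdiff s2 mxδ]
    change P.prob _ + (P.prob _ - P.prob _) = y
    rw [px, pxδ, pyδ]
    ring
  simp only [hL.indicatorRV_eq] at h
  rwa [hi, hu, hd, px, pxδ, pyδ] at h

/-! ### Distorted Choquet integrals -/

theorem IsConcaveDistortion.isCapacity {h : ℝ → ℝ} (hh : IsConcaveDistortion h)
    (P : Scenario Ω) : IsCapacity fun A => h (P.prob A) where
  mono _ _ hAB := hh.monotone (P.prob_mem_Icc _) (P.prob_mem_Icc _) (P.prob_mono hAB)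
  empty := by rw [P.prob_empty, hh.zero]
  univ := by rw [P.prob_univ, hh.one]

theorem IsConcaveDistortion.submodular {h : ℝ → ℝ} (hh : IsConcaveDistortion h)
    (P : Scenario Ω) (A B : Set Ω) (hB : MeasurableSet B) :
    h (P.prob (A ∪ B)) + h (P.prob (A ∩ B)) ≤ h (P.prob A) + h (P.prob B) := by
  rw [add_comm]
  refine add_le_add_of_concaveOn hh.concave (P.prob_mem_Icc _) (P.prob_mem_Icc _)
    (P.prob_mono inter_subset_left) (P.prob_mono inter_subset_right) ?_
  rw [add_comm (P.prob (A ∩ B))]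
  exact (measureReal_union_add_inter hB).symm

theorem choquet_eq_of_sameLaw (h : ℝ → ℝ) {X Y : BoundedRV Ω} {P Q : Scenario Ω}
    (hXY : SameLaw X P Y Q) :
    choquet X.1 (fun A => h (P.prob A)) = choquet Y.1 (fun A => h (Q.prob A)) := by
  have hl : ∀ x : ℝ, P.prob {ω | x ≤ X.1 ω} = Q.prob {ω | x ≤ Y.1 ω} := by
    intro x
    have h1 := congrArg (fun μ => μ.real (Ici x)) hXY
    simp only [map_measureReal_apply X.2.1 measurableSet_Ici,
      map_measureReal_apply Y.2.1 measurableSet_Ici] at h1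
    exact h1
  simp only [choquet, hl, P.prob_univ, Q.prob_univ]

theorem IsConcaveDistortion.ambiguitySensitive {h : ℝ → ℝ} (hh : IsConcaveDistortion h)
    (hΨ : ∀ (X : BoundedRV Ω) (P : Scenario Ω), Ψ X P = choquet X.1 fun A => h (P.prob A)) :
    Ψ.AmbiguitySensitive := by
  refine ⟨fun X P Q t ht => ?_, fun A hA P Q t ht hPQ => ?_⟩
  · obtain ⟨C, hC⟩ := X.2.2
    have hC' : ∀ ω, |X.1 ω| ≤ |C| := fun ω => (hC ω).trans (le_abs_self C)
    have h0 := abs_nonneg C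
    have hrep : ∀ R : Scenario Ω, Ψ X R
        = (∫ x in -|C|..|C|, h (R.prob {ω | x ≤ X.1 ω})) + -|C| := fun R =>
      (hΨ X R).trans (choquet_eq_integral (hh.isCapacity R) (neg_nonpos.2 h0) h0
        (fun ω => (abs_le.1 (hC' ω)).1) fun ω => (abs_le.1 (hC' ω)).2)
    have hint : ∀ R : Scenario Ω, IntervalIntegrable (fun x => h (R.prob {ω | x ≤ X.1 ω}))
        volume (-|C|) |C| := fun R =>
      ((hh.isCapacity R).antitone_superlevel X.1).intervalIntegrable
    have hle : (∫ x in -|C|..|C|, (t * h (P.prob {ω | x ≤ X.1 ω})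
          + (1 - t) * h (Q.prob {ω | x ≤ X.1 ω}))) ≤
        ∫ x in -|C|..|C|, h ((Scenario.mix t ht P Q).prob {ω | x ≤ X.1 ω}) := by
      refine intervalIntegral.integral_mono_on (by linarith)
        (((hint P).const_mul t).add ((hint Q).const_mul (1 - t))) (hint _) fun x _ => ?_
      rw [Scenario.prob_mix]
      exact hh.concave.2 (P.prob_mem_Icc _) (Q.prob_mem_Icc _) ht.1 (sub_nonneg.2 ht.2)
        (add_sub_cancel _ _)
    rw [intervalIntegral.integral_add ((hint P).const_mul t) ((hint Q).const_mul (1 - t)),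
      intervalIntegral.integral_const_mul, intervalIntegral.integral_const_mul] at hle
    rw [hrep, hrep, hrep]
    linarith
  · have hR : (Scenario.mix t ht P Q).prob A = Q.prob A := by
      rw [Scenario.prob_mix, hPQ]
      ring
    -- The indicator has the same law under `P`, `Q` and their mixture, so all three values
    -- coincide.
    rw [hΨ, hΨ, hΨ, choquet_eq_of_sameLaw h (sameLaw_indicatorRV hA hA hR),
      choquet_eq_of_sameLaw h (sameLaw_indicatorRV hA hA hPQ)]
    ring

theorem IsConcaveDistortion.coherent {h : ℝ → ℝ} (hh : IsConcaveDistortion h)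
    (hΨ : ∀ (X : BoundedRV Ω) (P : Scenario Ω), Ψ X P = choquet X.1 fun A => h (P.prob A)) :
    Ψ.Coherent := by
  refine ⟨fun P X Y hXY => ?_, fun P X m => ?_, fun P X c hc => ?_, fun P X Y => ?_⟩
  · obtain ⟨C, hC⟩ := X.2.2
    obtain ⟨D, hD⟩ := Y.2.2
    rw [hΨ, hΨ]
    exact choquet_mono (hh.isCapacity P) (C := max C D) (fun ω => (hC ω).trans (le_max_left _ _))
      (fun ω => (hD ω).trans (le_max_right _ _)) hXY
  · obtain ⟨C, hC⟩ := X.2.2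
    rw [hΨ, hΨ]
    exact choquet_add_const (hh.isCapacity P) hC m
  · obtain ⟨C, hC⟩ := X.2.2
    rw [hΨ, hΨ]
    exact choquet_const_mul (hh.isCapacity P) hC hc
  · obtain ⟨C, hC⟩ := X.2.2
    obtain ⟨D, hD⟩ := Y.2.2
    rw [hΨ, hΨ, hΨ]
    exact choquet_add_le (hh.isCapacity P) (fun A B _ hB => hh.submodular P A B hB) X.2.1 Y.2.1
      (C := max C D) (fun ω => (hC ω).trans (le_max_left _ _))
      (fun ω => (hD ω).trans (le_max_right _ _))

theorem IsConcaveDistortion.comonotonicAdditive {h : ℝ → ℝ} (hh : IsConcaveDistortion h)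
    (hΨ : ∀ (X : BoundedRV Ω) (P : Scenario Ω), Ψ X P = choquet X.1 fun A => h (P.prob A)) :
    Ψ.ComonotonicAdditive := by
  intro P X Y hXY
  obtain ⟨C, hC⟩ := X.2.2
  obtain ⟨D, hD⟩ := Y.2.2
  rw [hΨ, hΨ, hΨ]
  exact choquet_add_of_comonotonic (hh.isCapacity P) (C := max C D)
    (fun ω => (hC ω).trans (le_max_left _ _)) (fun ω => (hD ω).trans (le_max_right _ _)) hXY

end Distortion

end RiskCore

end

theorem theorem5 {Ω : Type*} [MeasurableSpace Ω] (Ψ : RiskCore.Core Ω) :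
    List.TFAE [
      Ψ.LossLawInvariant ∧ Ψ.AmbiguitySensitive ∧ Ψ.Monetary ∧ Ψ.ComonotonicAdditive,
      Ψ.StronglyLawInvariant ∧ Ψ.Coherent ∧ Ψ.ComonotonicAdditive,
      ∃ h : ℝ → ℝ, RiskCore.IsConcaveDistortion h ∧
        ∀ (X : RiskCore.BoundedRV Ω) (P : RiskCore.Scenario Ω),
          Ψ X P = RiskCore.choquet X.1 (fun A => h (P.prob A))] := by
  tfae_have 1 → 3 := fun ⟨hL, hS, hM, hC⟩ =>
    RiskCore.Core.exists_isConcaveDistortion hL hM hC (hS.concaveOn_distortion hL hM hC)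
      (hS.distortion_eqOn hL hM hC)
  tfae_have 2 → 3 := fun ⟨hL, hM, hC⟩ =>
    RiskCore.Core.exists_isConcaveDistortion (.of_strongly hL) ⟨hM.1, hM.2.1⟩ hC
      (RiskCore.Core.concaveOn_distortion_of_subadditive (.of_strongly hL) hM.1 hM.2.2.2 hC)
      hL.distortion_eqOn
  tfae_have 3 → 2 := fun ⟨h, hh, hΨ⟩ =>
    ⟨fun X Y P Q hXY => by rw [hΨ, hΨ, RiskCore.choquet_eq_of_sameLaw h hXY],
      hh.coherent hΨ, hh.comonotonicAdditive hΨ⟩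
  tfae_have 3 → 1 := fun ⟨h, hh, hΨ⟩ =>
    ⟨fun X Y P hXY => by rw [hΨ, hΨ, RiskCore.choquet_eq_of_sameLaw h hXY],
      hh.ambiguitySensitive hΨ, ⟨(hh.coherent hΨ).1, (hh.coherent hΨ).2.1⟩,
      hh.comonotonicAdditive hΨ⟩
  tfae_finish
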